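/- **Theorem (Security of lrv-id against collective attack).** Let $D=2^d$ with $d\ge 1$, so that $d=\log_2 D$ is the number of qubits of the qPUF, and consider the following $N$-round protocol ($N$ even, $N\le K$) between Alice and an adversary Eve. *Setup.* The qPUF is an unknown unitary $U$ on $\mathcal H^D$, i.e. $U$ is Haar-random in $U(D)$. Alice draws $K$ independent uniform strings $x_k\in\{0,1\}^d$ and a Haar-random unitary state generator $E$ on $\mathcal H^D$, independent of $U$. Her challenges are $|\phi^c_k\rangle=E|x_k\rangle$, the valid responses are $|\phi^r_k\rangle=U|\phi^c_k\rangle$, and the trap states are $|\phi^{\rm trap}_k\rangle=U|\phi^\perp_k\rangle$, where $|\phi_k^\perp\rangle=E|y_k\rangle$ with $y_k$ uniform among the strings different from $x_k$ (so $|\phi^\perp_k\rangle$ is uniformly random orthogonal to $|\phi^c_k\rangle$, and the trap is orthogonal to the valid response). Eve makes $q$ adaptive queries to $U$, interleaved with arbitrary quantum channels on the query register and a workspace, and stores the result in a database of $N$ (possibly entangled) quantum registers. *Identification.* Alice picks uniformly at random $N$ different indices among the $K$ and a subset of $N/2$ of the $N$ rounds; in round $i$ she sends $|\phi^c_i\rangle$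 together with $|\phi^b_i\rangle$, where $b=b_i=1$ and $|\phi^1_i\rangle=|\phi^r_i\rangle$ on the rounds of the subset, and $b=b_i=0$ and $|\phi^0_i\rangle=|\phi_i^{\rm trap}\rangle$ on the others. Eve performs a collective attack $\Lambda=\bigotimes_{i=1}^N\Lambda_i$: the CPTP map $\Lambda_i$ acts on $|\phi^c_i\rangle$, $|\phi^b_i\rangle$ and the $i$-th register of her database, and outputs one bit. Then every such adversary whose number of queries (database size) is $\mathrm{poly}\log D$ guesses each $b_i$ with a probability that differs negligibly from one half: for every polynomial $p$ there is a constant $C$ such that for all $d\ge1$, all even $N\le K$, every Eve with $q\le p(d)$ queries, and every round $i\in[N]$, $$\Big|\Pr\big[b_i\leftarrow\Lambda_i(|\phi^c_i\rangle,|\phi^b_i\rangle)\big]-\tfrac12\Big|\le C\,2^{-d},\qquad D=2^d .$$ In particular $\Pr[b_i\leftarrow\Lambda_i(|\phi^c_i\rangle,|\phi^b_i\rangle)]\le\frac12+O(2^{-d})$. No bound on Eve's computing power other than the number of queries is needed, so this covers all QPT adversaries. -/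

import Mathlib

open MeasureTheory Matrix Finset
open scoped BigOperators Kronecker ComplexOrder

namespace QPUF

/-! ### Haar measure on the unitary group -/

/-- The unitary group `U(D)`, with the rows and columns indexed by a type of `D` elements. -/
abbrev UGroup (n : Type) [Fintype n] [DecidableEq n] : Type := Matrix.unitaryGroup n ℂ

noncomputable instance (n : Type) [Fintype n] [DecidableEq n] : MeasurableSpace (UGroup n) := borel _

instance (n : Type) [Fintype n] [DecidableEq n] : BorelSpace (UGroup n) := ⟨rfl⟩

instance (n : Type) [Fintype n] [DecidableEq n] : CompactSpace (UGroup n) := by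
  refine isCompact_iff_compactSpace.mp ?_
  have hK : IsCompact (Set.univ.pi fun _ : n => Set.univ.pi fun _ : n =>
      Metric.closedBall (0 : ℂ) 1) :=
    isCompact_univ_pi fun _ => isCompact_univ_pi fun _ => isCompact_closedBall _ _
  refine IsCompact.of_isClosed_subset hK ?_ ?_
  · have h : ((Matrix.unitaryGroup n ℂ : Submonoid (Matrix n n ℂ)) : Set (Matrix n n ℂ))
        = {A | star A * A = 1} := by
      ext A
      exact Matrix.mem_unitaryGroup_iff'
    rw [h]
    exact isClosed_eq (by fun_prop) continuous_const
  · intro A hA i _ j _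
    simpa using entry_norm_bound_of_unitary hA i j

/-- The normalised Haar measure on `U(D)`. -/
noncomputable def haarU (n : Type) [Fintype n] [DecidableEq n] : Measure (UGroup n) :=
  Measure.haarMeasure ⊤

/-! ### Quantum channels -/

/-- A CPTP map from density matrices on `ℂ^a` to density matrices on `ℂ^b`, in Kraus form. -/
structure Channel (a b : Type) [Fintype a] [DecidableEq a] [Fintype b] where
  ι : Type
  [fintypeι : Fintype ι]
  kraus : ι → Matrix b a ℂ
  tracePreserving : ∑ k, (kraus k)ᴴ * kraus k = 1

attribute [instance] Channel.fintypeι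

/-- The action `ρ ↦ ∑ₖ Aₖ ρ Aₖ†` of a channel. -/
noncomputable def Channel.apply {a b : Type} [Fintype a] [DecidableEq a] [Fintype b]
    (Λ : Channel a b) (ρ : Matrix a a ℂ) : Matrix b b ℂ :=
  ∑ k, Λ.kraus k * ρ * (Λ.kraus k)ᴴ

/-- The product channel `⨂ᵢ Λᵢ`, which acts independently on the tensor factors. -/
noncomputable def Channel.pi {N : ℕ} {a b : Fin N → Type} [∀ i, Fintype (a i)]
    [∀ i, DecidableEq (a i)] [∀ i, Fintype (b i)] (Λ : ∀ i, Channel (a i) (b i)) :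
    Channel (∀ i, a i) (∀ i, b i) where
  ι := ∀ i, (Λ i).ι
  kraus k := Matrix.of fun s t => ∏ i, (Λ i).kraus (k i) (s i) (t i)
  tracePreserving := by
    ext s t
    have h : ∀ i, ∑ k, ∑ u, star ((Λ i).kraus k u (s i)) * (Λ i).kraus k u (t i)
        = if s i = t i then 1 else 0 := by
      intro i
      have := congrFun (congrFun (Λ i).tracePreserving (s i)) (t i)
      simpa [Matrix.sum_apply, Matrix.mul_apply, Matrix.one_apply] using this
    have h2 : ∏ i, ∑ k, ∑ u, star ((Λ i).kraus k u (s i)) * (Λ i).kraus k u (t i)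
        = (1 : Matrix (∀ i, a i) (∀ i, a i) ℂ) s t := by
      rw [Finset.prod_congr rfl fun i _ => h i, Finset.prod_ite_zero, Matrix.one_apply]
      simp [funext_iff]
    rw [← h2]
    simp only [Matrix.sum_apply, Matrix.mul_apply, Matrix.conjTranspose_apply, Matrix.of_apply,
      star_prod, ← Finset.prod_mul_distrib, Fintype.prod_sum]

/-! ### States -/

/-- The rank-one projector `|v⟩⟨v|`. -/
def proj {n : Type} (v : n → ℂ) : Matrix n n ℂ := Matrix.vecMulVec v (star v)

/-- Bit strings of length `d`; they label the computational basis of `ℋ^D`, `D = 2 ^ d`. -/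
abbrev Bits (d : ℕ) : Type := Fin d → Bool

/-- The basis vector `|x⟩`. -/
def ket {d : ℕ} (x : Bits d) : Bits d → ℂ := Pi.single x 1

/-! ### The adversary -/

/-- The input register of Eve's map in one round: her share (of dimension `m`) of the database,
the challenge state, and the state that Alice sends next to it. -/
abbrev RoundReg (d m : ℕ) : Type := Fin m × Bits d × Bits d

/-- An adversary against the `N`-round protocol with a qPUF on `ℋ^D`, `D = 2 ^ d`.

In the setup phase Eve makes `queries` adaptive queries to the qPUF: she starts from a state on
the query register and a workspace, and applies `step t` after query number `t` (from `0`).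
After the last query `store` writes her database, possibly entangled, into `N` registers.
The collective attack applies the map `attack i` to the `i`-th register of the database together
with the `i`-th pair that Alice sends; its output is a bit. -/
structure Eve (d N : ℕ) where
  queries : ℕ
  workDim : ℕ
  init : Matrix (Bits d × Fin workDim) (Bits d × Fin workDim) ℂ
  init_posSemidef : init.PosSemidef
  init_trace : init.trace = 1
  step : ℕ → Channel (Bits d × Fin workDim) (Bits d × Fin workDim)
  memDim : Fin N → ℕ
  store : Channel (Bits d × Fin workDim) (∀ i, Fin (memDim i))
  attack : ∀ i, Channel (RoundReg d (memDim i)) Bool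

namespace Eve

variable {d N : ℕ}

/-- Eve's state after `t` queries to the qPUF `U`. -/
noncomputable def stateAfter (A : Eve d N) (U : UGroup (Bits d)) :
    ℕ → Matrix (Bits d × Fin A.workDim) (Bits d × Fin A.workDim) ℂ
  | 0 => A.init
  | t + 1 =>
    (A.step t).apply
      (((U : Matrix (Bits d) (Bits d) ℂ) ⊗ₖ (1 : Matrix (Fin A.workDim) (Fin A.workDim) ℂ)) *
        stateAfter A U t *
        ((U : Matrix (Bits d) (Bits d) ℂ) ⊗ₖ (1 : Matrix (Fin A.workDim) (Fin A.workDim) ℂ))ᴴ)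

/-- Eve's database at the end of the setup phase. -/
noncomputable def database (A : Eve d N) (U : UGroup (Bits d)) :
    Matrix (∀ i, Fin (A.memDim i)) (∀ i, Fin (A.memDim i)) ℂ :=
  A.store.apply (A.stateAfter U A.queries)

/-- The joint input of Eve's maps: her database and, for each round `i`, the challenge `c i` and
the state `r i` that comes with it. -/
noncomputable def roundsInput (A : Eve d N) (U : UGroup (Bits d)) (c r : Fin N → Bits d → ℂ) :
    Matrix (∀ i, RoundReg d (A.memDim i)) (∀ i, RoundReg d (A.memDim i)) ℂ :=
  Matrix.of fun s t =>
    A.database U (fun i => (s i).1) (fun i => (t i).1) *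
      ∏ i, (proj (c i) (s i).2.1 (t i).2.1 * proj (r i) (s i).2.2 (t i).2.2)

/-- The probability that the product map `⨂ᵢ Λᵢ` outputs the string `S`. -/
noncomputable def outputProb (A : Eve d N) (U : UGroup (Bits d)) (c r : Fin N → Bits d → ℂ)
    (S : Fin N → Bool) : ℝ :=
  ((Channel.pi A.attack).apply (A.roundsInput U c r) S S).re

/-- The probability that the output bit of round `i` is the bit `b`. -/
noncomputable def outputBitProb (A : Eve d N) (U : UGroup (Bits d)) (c r : Fin N → Bits d → ℂ)
    (i : Fin N) (b : Bool) : ℝ :=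
  ∑ S : Fin N → Bool with S i = b, A.outputProb U c r S

end Eve

/-! ### The protocol -/

/-- The probability that Eve guesses the bit `b` of round `i` in `lrv-id`:

* the qPUF `U` is an unknown, i.e. Haar-random, unitary;
* Alice draws `K` uniform strings `x k` and a Haar-random state generator `E`; her challenges are
  `E|x k⟩`, and her states orthogonal to them are `E|y k⟩` with `y k` uniform among the
  strings other than `x k`; the valid responses are `U E|x k⟩` and the traps `U E|y k⟩`;
* Alice picks `N` different challenges `sel 0, …, sel (N - 1)` and a set `P` of `N / 2` positions,
  both uniformly; the bit of a round is `1` iff it lies in `P`, and Eve receives the challenge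
  with the valid response on the rounds in `P` and with the trap on the others. -/
noncomputable def guessProb (d N K : ℕ) (A : Eve d N) (i : Fin N) : ℝ :=
  ∫ U : UGroup (Bits d), ∫ E : UGroup (Bits d),
    (𝔼 x : Fin K → Bits d, 𝔼 y : (∀ k, {z : Bits d // z ≠ x k}),
      𝔼 sel : Fin N ↪ Fin K, 𝔼 P ∈ powersetCard (N / 2) (univ : Finset (Fin N)),
        A.outputBitProb U
          (fun j => E.1 *ᵥ ket (x (sel j)))
          (fun j => if j ∈ P then U.1 *ᵥ (E.1 *ᵥ ket (x (sel j)))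
            else U.1 *ᵥ (E.1 *ᵥ ket (y (sel j)).1))
          i (decide (i ∈ P)))
    ∂haarU (Bits d) ∂haarU (Bits d)

end QPUF

/-! Write `D = 2 ^ d`, and let `F` be the swap on the challenge register and the register of the
accompanying state. Averaging over the state generator `E` turns the pair before the qPUF acts into
`(1 + F) / (D (D + 1))` in a valid round and into `(D - F) / (D (D² - 1))` in a trap round
(`second_moment`). The difference is `(D F - 1) / (D (D² - 1))`. Applying `U` to the second factor
changes `F` into `F (U ⊗ U†)`. Since the attack is a product map, the other rounds drop out of the
statistics of bit `i` (`Eve.outputBitProb_eq`). The bias is therefore controlled by the Haar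
integral of `tr (M (F (U ⊗ U†) ⊗ database U))` for an observable `M` of norm at most one
(`integral_round`).

The trivial bound on that integral is `D²`, which only gives a constant bias; the bound needed is `D
+ O(q²)`. It comes from the Heisenberg picture: `M` is evolved backwards through the `q` queries,
and the extra `U` and `U†` act on two registers that Eve's steps do not touch. Integration by parts
on the unitary group (`HasTwist.integral`) along such a register gains a factor `1 / D` and replaces
the extra `U` with a sum of terms in which a swap is inserted at one of the other occurrences of `U`
or `U†`. Swaps are contractions, so only the number of terms matters. The term that pairs the extra
`U` with the extra `U†` is bounded at once; the others still contain the extra `U†`, and a second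
integration by parts gives another factor `1 / D` at the cost of `O(q²)` terms
(`norm_integral_heis_le`).

Altogether the bias is at most `(D (D + 8q² + 2q) + D²) / (2 D (D² - 1))`, which is `O(1 / D)`
because `q²` is at most a constant times `2 ^ d`. -/

namespace QPUF

open scoped Matrix.Norms.L2Operator

/-! ### Invariance of Haar measure and vanishing integrals of derivatives along one-parameter groups
-/

section Haar

variable {n : Type} [Fintype n] [DecidableEq n]

instance : (haarU n).IsHaarMeasure := by unfold haarU; infer_instance

instance : IsProbabilityMeasure (haarU n) :=
  ⟨by simpa [haarU] using Measure.haarMeasure_self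
        (K₀ := (⊤ : TopologicalSpace.PositiveCompacts (UGroup n)))⟩

/-- Compact groups are unimodular: the image under a right translation is again a Haar probability
measure, and there is only one. -/
instance : (haarU n).IsMulRightInvariant where
  map_mul_right_eq_self g := by
    have : IsProbabilityMeasure (Measure.map (· * g) (haarU n)) :=
      Measure.isProbabilityMeasure_map (measurable_mul_const g).aemeasurable
    have : (Measure.map (· * g) (haarU n)).IsHaarMeasure :=
      { lt_top_of_isCompact := fun K _ => measure_lt_top _ _
        toIsOpenPosMeasure := (continuous_mul_const g).isOpenPosMeasure_map
          (mul_right_surjective g) }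
    exact Measure.isHaarMeasure_eq_of_isProbabilityMeasure _ _

theorem integrable_of_continuous {E : Type*} [NormedAddCommGroup E] {f : UGroup n → E}
    (hf : Continuous f) : Integrable f (haarU n) :=
  hf.integrable_of_hasCompactSupport (HasCompactSupport.of_compactSpace f)

/-- The one-parameter group `s ↦ exp (i s H)`. -/
noncomputable def expCurve (H : selfAdjoint (Matrix n n ℂ)) (s : ℝ) : UGroup n :=
  selfAdjoint.expUnitary (s • H)

theorem expCurve_zero (H : selfAdjoint (Matrix n n ℂ)) : expCurve H 0 = 1 := by
  simp [expCurve]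

theorem expCurve_add (H : selfAdjoint (Matrix n n ℂ)) (s t : ℝ) :
    expCurve H (s + t) = expCurve H s * expCurve H t := by
  rw [expCurve, add_smul]
  refine Commute.expUnitary_add ?_
  simp only [selfAdjoint.val_smul]
  exact ((Commute.refl _).smul_left s).smul_right t

theorem hasDerivAt_expCurve (H : selfAdjoint (Matrix n n ℂ)) :
    HasDerivAt (fun s => (expCurve H s : Matrix n n ℂ)) (Complex.I • (H : Matrix n n ℂ)) 0 := by
  have h := hasDerivAt_exp_smul_const (𝕂 := ℝ) (Complex.I • (H : Matrix n n ℂ)) 0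
  simp only [zero_smul, NormedSpace.exp_zero, one_mul] at h
  refine h.congr_of_eventuallyEq (Filter.Eventually.of_forall fun s => ?_)
  simp [expCurve, smul_comm Complex.I s]

/-- A smooth measure-preserving flow on the unitary group annihilates derivatives. -/
theorem integral_deriv_flow_eq_zero (Φ : ℝ → UGroup n → UGroup n)
    (hΦ : ∀ s, MeasurePreserving (Φ s) (haarU n) (haarU n)) (hc : ∀ s, Continuous (Φ s))
    (hadd : ∀ s t U, Φ (s + t) U = Φ s (Φ t U)) {f f' : UGroup n → ℂ} (hf : Continuous f)
    (hf' : Continuous f') (hd : ∀ U, HasDerivAt (fun s => f (Φ s U)) (f' U) 0) :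
    ∫ U, f' U ∂haarU n = 0 := by
  obtain ⟨C, hC⟩ := (isCompact_range hf'.norm).bddAbove
  -- The flow property carries the derivative at time `0` to every other time.
  have hd' : ∀ U s, HasDerivAt (fun s => f (Φ s U)) (f' (Φ s U)) s := by
    intro U s
    have h := hd (Φ s U)
    rw [← sub_self s] at h
    have h2 := h.comp_sub_const s s
    simpa [← hadd] using h2
  have h := (hasDerivAt_integral_of_dominated_loc_of_deriv_le (μ := haarU n) (x₀ := (0 : ℝ))
    (F := fun s U => f (Φ s U)) (F' := fun s U => f' (Φ s U)) (bound := fun _ => C) (s := Set.univ)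
    Filter.univ_mem
    (Filter.Eventually.of_forall fun s => (hf.comp (hc s)).aestronglyMeasurable)
    (integrable_of_continuous (hf.comp (hc 0))) (hf'.comp (hc 0)).aestronglyMeasurable
    (Filter.Eventually.of_forall fun U s _ => hC ⟨_, rfl⟩) (integrable_const C)
    (Filter.Eventually.of_forall fun U s _ => hd' U s)).2
  -- Since the flow preserves the measure, the integral does not depend on `s`, and its derivative,
  -- the integral of `f'`, is zero.
  have hconst : ∀ s, ∀ g : UGroup n → ℂ, Continuous g →
      ∫ U, g (Φ s U) ∂haarU n = ∫ U, g U ∂haarU n := by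
    intro s g hg
    conv_rhs => rw [← (hΦ s).map_eq]
    rw [integral_map (hΦ s).measurable.aemeasurable hg.aestronglyMeasurable]
  simp only [hconst _ f hf, hconst _ f' hf'] at h
  exact h.unique (hasDerivAt_const _ _)

theorem integral_deriv_left_eq_zero (H : selfAdjoint (Matrix n n ℂ)) {f f' : UGroup n → ℂ}
    (hf : Continuous f) (hf' : Continuous f')
    (hd : ∀ U, HasDerivAt (fun s => f (expCurve H s * U)) (f' U) 0) :
    ∫ U, f' U ∂haarU n = 0 :=
  integral_deriv_flow_eq_zero (fun s U => expCurve H s * U)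
    (fun s => measurePreserving_mul_left _ _) (fun s => continuous_const_mul _)
    (fun s t U => by simp only [expCurve_add, mul_assoc]) hf hf' hd

theorem integral_deriv_right_eq_zero (H : selfAdjoint (Matrix n n ℂ)) {f f' : UGroup n → ℂ}
    (hf : Continuous f) (hf' : Continuous f')
    (hd : ∀ U, HasDerivAt (fun s => f (U * expCurve H s)) (f' U) 0) :
    ∫ U, f' U ∂haarU n = 0 :=
  integral_deriv_flow_eq_zero (fun s U => U * expCurve H s)
    (fun s => measurePreserving_mul_right _ _) (fun s => continuous_mul_const _)
    (fun s t U => by simp only [add_comm s t, expCurve_add, mul_assoc]) hf hf' hd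

/-- A complex-linear identity that holds on `i H` for Hermitian `H` holds everywhere. -/
theorem linearMap_eq_zero_of_skew {E : Type*} [AddCommGroup E] [Module ℂ E]
    (L : Matrix n n ℂ →ₗ[ℂ] E)
    (h : ∀ H : selfAdjoint (Matrix n n ℂ), L (Complex.I • (H : Matrix n n ℂ)) = 0) : L = 0 := by
  ext1 X
  have h' : ∀ H : selfAdjoint (Matrix n n ℂ), L (H : Matrix n n ℂ) = 0 := fun H => by
    have := h H
    rw [map_smul] at this
    exact (smul_eq_zero.mp this).resolve_left Complex.I_ne_zero
  rw [← realPart_add_I_smul_imaginaryPart X, map_add, map_smul, h', h']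
  simp

end Haar

/-! ### Commuting registers, swap operators and integration by parts -/

section Registers

variable {n : Type} [Fintype n] [DecidableEq n] {A : Type*} [CStarAlgebra A]

theorem continuous_register (κ : Matrix n n ℂ →⋆ₐ[ℂ] A) : Continuous κ :=
  LinearMap.continuous_of_finiteDimensional (κ : Matrix n n ℂ →ₐ[ℂ] A).toLinearMap

theorem norm_register_unitary_le (κ : Matrix n n ℂ →⋆ₐ[ℂ] A) (U : UGroup n) :
    ‖κ (U : Matrix n n ℂ)‖ ≤ 1 := by
  refine (NonUnitalStarAlgHom.norm_apply_le κ _).trans ?_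
  rcases isEmpty_or_nonempty n with h | h
  · simp [Subsingleton.elim (U : Matrix n n ℂ) 0]
  · exact (CStarRing.norm_of_mem_unitary U.2).le

theorem norm_register_unitary_star_le (κ : Matrix n n ℂ →⋆ₐ[ℂ] A) (U : UGroup n) :
    ‖κ (star (U : Matrix n n ℂ))‖ ≤ 1 := by
  rw [map_star, norm_star]
  exact norm_register_unitary_le κ U

/-- The operator that exchanges two registers. -/
noncomputable def swapOp (ι κ : Matrix n n ℂ →⋆ₐ[ℂ] A) : A :=
  ∑ a, ∑ b, ι (single a b 1) * κ (single b a 1)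

variable {ι κ : Matrix n n ℂ →⋆ₐ[ℂ] A}

theorem swapOp_comm (h : ∀ X Y, Commute (ι X) (κ Y)) : swapOp ι κ = swapOp κ ι := by
  unfold swapOp
  rw [Finset.sum_comm]
  exact Finset.sum_congr rfl fun a _ => Finset.sum_congr rfl fun b _ => h _ _

theorem star_swapOp (h : ∀ X Y, Commute (ι X) (κ Y)) : star (swapOp ι κ) = swapOp ι κ := by
  have h1 : ∀ a b : n, star (single a b (1 : ℂ)) = single b a 1 := fun a b => by
    simp [star_eq_conjTranspose]
  simp only [swapOp, star_sum, star_mul, ← map_star, h1, (h _ _).eq]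
  exact Finset.sum_comm

/-- On a matrix unit `e_ij` both sides collapse to `∑ b, ι e_ib * κ e_bj`. The registers need not
commute here, since `X` multiplies each product from the outside. -/
theorem register_mul_swapOp (X : Matrix n n ℂ) :
    ι X * swapOp ι κ = swapOp ι κ * κ X := by
  induction X using Matrix.induction_on' with
  | h_zero => simp
  | h_add p q hp hq => rw [map_add, map_add, add_mul, mul_add, hp, hq]
  | h_std_basis i j x =>
    have h1 : single i j x = x • single i j (1 : ℂ) := by simp
    rw [h1, map_smul, map_smul, smul_mul_assoc, mul_smul_comm]
    congr 1
    simp only [swapOp, Finset.mul_sum, Finset.sum_mul, ← mul_assoc, ← map_mul]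
    simp only [mul_assoc, ← map_mul]
    have h2 : ∑ a, ∑ b, ι (single i j 1 * single a b 1) * κ (single b a 1)
        = ∑ b, ι (single i b 1) * κ (single b j 1) := by
      rw [Finset.sum_eq_single j (fun a _ ha => ?_) (by simp)]
      · simp
      · simp [single_mul_single_of_ne _ _ _ _ ha.symm]
    have h3 : ∑ a, ∑ b, ι (single a b 1) * κ (single b a 1 * single i j 1)
        = ∑ b, ι (single i b 1) * κ (single b j 1) := by
      rw [Finset.sum_eq_single i (fun a _ ha => ?_) (by simp)]
      · simp
      · simp [single_mul_single_of_ne _ _ _ _ ha]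
    rw [h3, ← h2]

theorem register_mul_swapOp' (h : ∀ X Y, Commute (ι X) (κ Y)) (X : Matrix n n ℂ) :
    κ X * swapOp ι κ = swapOp ι κ * ι X := by
  rw [swapOp_comm h, register_mul_swapOp]

theorem sum_single_diag : ∑ a : n, single a a (1 : ℂ) = 1 := by
  ext i j
  simp [Matrix.sum_apply, single_apply, one_apply, ite_and]

theorem swapOp_mul_self (h : ∀ X Y, Commute (ι X) (κ Y)) : swapOp ι κ * swapOp ι κ = 1 := by
  have : ∀ a b, ι (single a b 1) * κ (single b a 1) * swapOp ι κ
      = ι (single a a 1) * κ (single b b 1) := by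
    intro a b
    rw [mul_assoc, register_mul_swapOp' h, ← mul_assoc]
    simp only [swapOp, Finset.sum_mul, Finset.mul_sum, mul_assoc, ← (h _ _).eq]
    simp only [← mul_assoc, ← map_mul, single_mul_mul_single]
    simp [single_apply, ite_and, apply_ite]
  conv_lhs => enter [1]; rw [swapOp]
  simp only [Finset.sum_mul, this]
  simp only [← Finset.mul_sum, ← map_sum, sum_single_diag, map_one, mul_one]

/-- A self-adjoint element with square one has norm one, by the C⋆-identity. In the zero algebra the
norm is zero. -/
theorem norm_swapOp_le (h : ∀ X Y, Commute (ι X) (κ Y)) : ‖swapOp ι κ‖ ≤ 1 := by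
  rcases subsingleton_or_nontrivial A with hA | hA
  · simp [Subsingleton.elim (swapOp ι κ) 0]
  · have := CStarRing.norm_star_mul_self (x := swapOp ι κ)
    rw [star_swapOp h, swapOp_mul_self h, norm_one] at this
    nlinarith [norm_nonneg (swapOp ι κ)]

/-- `f` is differentiable along the one-parameter groups; its derivative in the direction `X` is
`K X - B X`, where `K` comes from the factors `U` and `B` from the factors `U†`. The functions
`Kt` and `Bt` are the contractions of `K` and `B` with the register `ι`. -/
def HasTwist (ι : Matrix n n ℂ →⋆ₐ[ℂ] A) (f Kt Bt : UGroup n → A) : Prop :=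
  Continuous f ∧ ∃ K B : Matrix n n ℂ →ₗ[ℂ] (UGroup n → A),
    (∀ X, Continuous (K X)) ∧ (∀ X, Continuous (B X)) ∧
    (∀ (H : selfAdjoint (Matrix n n ℂ)) (U : UGroup n),
      HasDerivAt (fun s : ℝ => f (expCurve H s * U))
        (K (Complex.I • (H : Matrix n n ℂ)) U - B (Complex.I • (H : Matrix n n ℂ)) U) 0) ∧
    (∀ U, Kt U = ∑ a, ∑ b, K (single b a 1) U * ι (single a b 1)) ∧
    (∀ U, Bt U = ∑ a, ∑ b, ι (single a b 1 * (U : Matrix n n ℂ)) * B (single b a 1) U)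

theorem HasTwist.const (ι : Matrix n n ℂ →⋆ₐ[ℂ] A) (z : A) :
    HasTwist ι (fun _ => z) (fun _ => 0) (fun _ => 0) :=
  ⟨continuous_const, 0, 0, fun _ => continuous_const, fun _ => continuous_const,
    fun H U => by simpa using hasDerivAt_const (0 : ℝ) z, by simp, by simp⟩

theorem HasTwist.add {f Kt Bt g Kt' Bt' : UGroup n → A} (hf : HasTwist ι f Kt Bt)
    (hg : HasTwist ι g Kt' Bt') :
    HasTwist ι (fun U => f U + g U) (fun U => Kt U + Kt' U) (fun U => Bt U + Bt' U) := by
  obtain ⟨cf, K, B, cK, cB, hd, hK, hB⟩ := hf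
  obtain ⟨cg, K', B', cK', cB', hd', hK', hB'⟩ := hg
  refine ⟨cf.add cg, K + K', B + B', fun X => (cK X).add (cK' X), fun X => (cB X).add (cB' X),
    fun H U => ?_, fun U => ?_, fun U => ?_⟩
  · refine ((hd H U).add (hd' H U)).congr_deriv ?_
    simp only [LinearMap.add_apply, Pi.add_apply]
    abel
  · simp [hK, hK', add_mul, Finset.sum_add_distrib]
  · simp [hB, hB', mul_add, Finset.sum_add_distrib]

/-- Contracting with `ι` multiplies by elements of that register on one side, so `L` must be linear
over the register on both sides to pass through the contractions. -/
theorem HasTwist.map {f Kt Bt : UGroup n → A} (hf : HasTwist ι f Kt Bt) (L : A →L[ℂ] A)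
    (hr : ∀ x X, L (x * ι X) = L x * ι X) (hl : ∀ x X, L (ι X * x) = ι X * L x) :
    HasTwist ι (fun U => L (f U)) (fun U => L (Kt U)) (fun U => L (Bt U)) := by
  obtain ⟨cf, K, B, cK, cB, hd, hK, hB⟩ := hf
  refine ⟨L.continuous.comp cf, L.toLinearMap.compLeft _ ∘ₗ K, L.toLinearMap.compLeft _ ∘ₗ B,
    fun X => L.continuous.comp (cK X), fun X => L.continuous.comp (cB X),
    fun H U => ?_, fun U => ?_, fun U => ?_⟩
  · have := (L.restrictScalars ℝ).hasFDerivAt.comp_hasDerivAt (0 : ℝ) (hd H U)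
    simpa [Function.comp_def] using this
  · simp [hK, hr]
  · simp only [hB, map_sum, hl]
    rfl

theorem hasDerivAt_register (κ : Matrix n n ℂ →⋆ₐ[ℂ] A) (H : selfAdjoint (Matrix n n ℂ))
    (U : UGroup n) :
    HasDerivAt (fun s : ℝ => κ ((expCurve H s * U : UGroup n) : Matrix n n ℂ))
      (κ ((Complex.I • (H : Matrix n n ℂ)) * (U : Matrix n n ℂ))) 0 := by
  have h := (hasDerivAt_expCurve H).mul_const (U : Matrix n n ℂ)
  let κ' : Matrix n n ℂ →L[ℂ] A := ⟨(κ : Matrix n n ℂ →ₐ[ℂ] A).toLinearMap, continuous_register κ⟩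
  exact (κ'.restrictScalars ℝ).hasFDerivAt.comp_hasDerivAt (0 : ℝ) h

theorem hasDerivAt_register_star (κ : Matrix n n ℂ →⋆ₐ[ℂ] A) (H : selfAdjoint (Matrix n n ℂ))
    (U : UGroup n) :
    HasDerivAt (fun s : ℝ => κ (star ((expCurve H s * U : UGroup n) : Matrix n n ℂ)))
      (-κ (star (U : Matrix n n ℂ) * (Complex.I • (H : Matrix n n ℂ)))) 0 := by
  have h := (hasDerivAt_register κ H U).star
  simp only [← map_star] at h
  refine h.congr_deriv ?_
  rw [← map_neg]
  congr 1
  simp [H.2.star_eq]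

/-- Product rule. The new factor contributes `κ (X * U)` to `K`; contracting `κ e_ba` with `ι e_ab`
leaves a swap in front of `κ U`. Nothing new enters `B`. -/
theorem HasTwist.mul_gate {f Kt Bt : UGroup n → A} (hf : HasTwist ι f Kt Bt)
    (h : ∀ X Y, Commute (ι X) (κ Y)) :
    HasTwist ι (fun U => f U * κ U) (fun U => Kt U * κ U + f U * swapOp ι κ * κ U)
      (fun U => Bt U * κ U) := by
  obtain ⟨cf, K, B, cK, cB, hd, hK, hB⟩ := hf
  have cκ : Continuous fun U : UGroup n => κ (U : Matrix n n ℂ) :=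
    (continuous_register κ).comp continuous_subtype_val
  refine ⟨cf.mul cκ,
    { toFun := fun X U => K X U * κ U + f U * κ (X * U)
      map_add' := fun X Y => by ext U; simp [add_mul, mul_add]; abel
      map_smul' := fun c X => by ext U; simp },
    { toFun := fun X U => B X U * κ U
      map_add' := fun X Y => by ext U; simp [add_mul]
      map_smul' := fun c X => by ext U; simp },
    fun X => ?_, fun X => (cB X).mul cκ, fun H U => ?_, fun U => ?_, fun U => ?_⟩
  · exact ((cK X).mul cκ).add (cf.mul ((continuous_register κ).comp
      (continuous_const.mul continuous_subtype_val)))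
  · refine ((hd H U).mul (hasDerivAt_register κ H U)).congr_deriv ?_
    simp only [LinearMap.coe_mk, AddHom.coe_mk, expCurve_zero, one_mul, sub_mul]
    abel
  · simp only [LinearMap.coe_mk, AddHom.coe_mk, add_mul, Finset.sum_add_distrib, hK, swapOp,
      Finset.sum_mul, Finset.mul_sum]
    congr 1
    · refine Finset.sum_congr rfl fun a _ => Finset.sum_congr rfl fun b _ => ?_
      rw [mul_assoc, mul_assoc, (h _ _).eq]
    · refine Finset.sum_congr rfl fun a _ => Finset.sum_congr rfl fun b _ => ?_
      rw [mul_assoc, mul_assoc, mul_assoc, ← map_mul, (h _ _).eq]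
  · simp [hB, Finset.sum_mul, mul_assoc]

/-- Product rule for a factor `U†`, whose derivative is `-κ (U† X)`. The contraction for `B` carries
the integrated `U` in the register `ι`; moved through the swap it meets `U†` and cancels, so that a
bare swap is left. -/
theorem HasTwist.gate_mul {f Kt Bt : UGroup n → A} (hf : HasTwist ι f Kt Bt)
    (h : ∀ X Y, Commute (ι X) (κ Y)) :
    HasTwist ι (fun U => κ (star (U : Matrix n n ℂ)) * f U)
      (fun U => κ (star (U : Matrix n n ℂ)) * Kt U)
      (fun U => κ (star (U : Matrix n n ℂ)) * Bt U + swapOp ι κ * f U) := by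
  obtain ⟨cf, K, B, cK, cB, hd, hK, hB⟩ := hf
  have cκ : Continuous fun U : UGroup n => κ (star (U : Matrix n n ℂ)) :=
    (continuous_register κ).comp continuous_subtype_val.star
  refine ⟨cκ.mul cf,
    { toFun := fun X U => κ (star (U : Matrix n n ℂ)) * K X U
      map_add' := fun X Y => by ext U; simp [mul_add]
      map_smul' := fun c X => by ext U; simp },
    { toFun := fun X U => κ (star (U : Matrix n n ℂ)) * B X U
        + κ (star (U : Matrix n n ℂ) * X) * f U
      map_add' := fun X Y => by ext U; simp [add_mul, mul_add]; abel
      map_smul' := fun c X => by ext U; simp },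
    fun X => cκ.mul (cK X), fun X => ?_, fun H U => ?_, fun U => ?_, fun U => ?_⟩
  · exact (cκ.mul (cB X)).add (((continuous_register κ).comp
      (continuous_subtype_val.star.mul continuous_const)).mul cf)
  · refine ((hasDerivAt_register_star κ H U).mul (hd H U)).congr_deriv ?_
    simp only [LinearMap.coe_mk, AddHom.coe_mk, expCurve_zero, one_mul, mul_sub, neg_mul]
    abel
  · simp [hK, Finset.mul_sum, mul_assoc]
  · simp only [LinearMap.coe_mk, AddHom.coe_mk, mul_add, Finset.sum_add_distrib, hB,
      Finset.mul_sum]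
    congr 1
    · refine Finset.sum_congr rfl fun a _ => Finset.sum_congr rfl fun b _ => ?_
      rw [← mul_assoc, ← mul_assoc, (h _ _).eq]
    · simp only [← mul_assoc, ← Finset.sum_mul]
      congr 1
      -- Moving `ι U` to the left through the swap makes it `κ U`, next to `κ U†`.
      have h1 : swapOp ι κ = κ (star (U : Matrix n n ℂ)) * swapOp ι κ * ι (U : Matrix n n ℂ) := by
        rw [mul_assoc, ← register_mul_swapOp' h, ← mul_assoc, ← map_mul]
        simp
      rw [h1]
      simp only [swapOp, Finset.mul_sum, Finset.sum_mul]
      refine Finset.sum_congr rfl fun a _ => Finset.sum_congr rfl fun b _ => ?_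
      rw [map_mul, map_mul]
      have h2 := (h (single a b 1) (star (U : Matrix n n ℂ))).eq
      have h3 := (h (U : Matrix n n ℂ) (single b a 1)).eq
      have h4 := (h (U : Matrix n n ℂ) (star (U : Matrix n n ℂ))).eq
      rw [← mul_assoc (κ _), ← h2, mul_assoc, mul_assoc, mul_assoc, ← h3,
        ← mul_assoc (κ _) (ι _), ← h4, mul_assoc]

/-- Integration by parts on the unitary group. -/
theorem HasTwist.integral {f Kt Bt : UGroup n → A} (hf : HasTwist ι f Kt Bt) (τ : A →L[ℂ] ℂ)
    (hτ : ∀ x X, τ (x * ι X) = τ (ι X * x)) :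
    (Fintype.card n : ℂ) * ∫ U, τ (f U * ι U) ∂haarU n
      = ∫ U, τ (Bt U) ∂haarU n - ∫ U, τ (Kt U * ι U) ∂haarU n := by
  obtain ⟨cf, K, B, cK, cB, hd, hK, hB⟩ := hf
  have cι : ∀ X : Matrix n n ℂ, Continuous fun U : UGroup n => ι (X * (U : Matrix n n ℂ)) :=
    fun X => (continuous_register ι).comp (continuous_const.mul continuous_subtype_val)
  have hint : ∀ g : UGroup n → A, Continuous g → Integrable (fun U => τ (g U)) (haarU n) :=
    fun g hg => integrable_of_continuous (τ.continuous.comp hg)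
  -- The function differentiated is `f U * ι (Y U)`. Real directions give the identity for `X = i
  -- H`; linearity over `ℂ` extends it to every `X`, matrix units included.
  have key : ∀ Y X : Matrix n n ℂ,
      ∫ U, τ ((K X U - B X U) * ι (Y * (U : Matrix n n ℂ))
        + f U * ι (Y * X * (U : Matrix n n ℂ))) ∂haarU n = 0 := by
    intro Y
    have cF : ∀ X, Continuous fun U : UGroup n => (K X U - B X U) * ι (Y * (U : Matrix n n ℂ))
        + f U * ι (Y * X * (U : Matrix n n ℂ)) :=
      fun X => (((cK X).sub (cB X)).mul (cι Y)).add (cf.mul (cι _))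
    let L : Matrix n n ℂ →ₗ[ℂ] ℂ :=
      { toFun := fun X => ∫ U, τ ((K X U - B X U) * ι (Y * (U : Matrix n n ℂ))
          + f U * ι (Y * X * (U : Matrix n n ℂ))) ∂haarU n
        map_add' := fun X X' => by
          rw [← integral_add (hint _ (cF X)) (hint _ (cF X'))]
          congr 1
          ext U
          rw [← map_add]
          congr 1
          simp only [map_add, Pi.add_apply, mul_add, add_mul, sub_mul]
          abel
        map_smul' := fun c X => by
          rw [RingHom.id_apply, ← integral_smul]
          congr 1
          ext U
          rw [← map_smul]
          congr 1
          simp [smul_sub, sub_mul] }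
    have hL : L = 0 := linearMap_eq_zero_of_skew L fun H => by
      refine integral_deriv_left_eq_zero H
        (f := fun U => τ (f U * ι (Y * (U : Matrix n n ℂ)))) (τ.continuous.comp (cf.mul (cι Y)))
        (τ.continuous.comp (cF _)) fun U => ?_
      have h1 := (hd H U).mul ((hasDerivAt_register ι H U).const_mul (ι Y))
      have h2 := (τ.restrictScalars ℝ).hasFDerivAt.comp_hasDerivAt (0 : ℝ) h1
      simpa [Function.comp_def, expCurve_zero, mul_assoc] using h2
    exact fun X => LinearMap.congr_fun hL X
  -- Taking `Y = e_ab` and `X = e_ba` and summing produces the factor `D`, because `∑ e_ab e_ba = D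
  -- • 1`.
  have hsum : ∫ U, τ (∑ a, ∑ b, ((K (single b a 1) U - B (single b a 1) U)
      * ι (single a b 1 * (U : Matrix n n ℂ))
        + f U * ι (single a b 1 * single b a 1 * (U : Matrix n n ℂ)))) ∂haarU n = 0 := by
    simp only [map_sum]
    rw [integral_finsetSum _ fun a _ => integrable_finsetSum _ fun b _ => hint _ ?_]
    · refine Finset.sum_eq_zero fun a _ => ?_
      rw [integral_finsetSum _ fun b _ => hint _ ?_]
      · exact Finset.sum_eq_zero fun b _ => key _ _
      · exact (((cK _).sub (cB _)).mul (cι _)).add (cf.mul (cι _))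
    · exact (((cK _).sub (cB _)).mul (cι _)).add (cf.mul (cι _))
  have hcK : Continuous Kt := by
    rw [funext hK]
    exact continuous_finsetSum _ fun a _ => continuous_finsetSum _ fun b _ =>
      (cK _).mul continuous_const
  have hcB : Continuous Bt := by
    rw [funext hB]
    exact continuous_finsetSum _ fun a _ => continuous_finsetSum _ fun b _ =>
      (cι _).mul (cB _)
  have cι1 : Continuous fun U : UGroup n => ι (U : Matrix n n ℂ) := by simpa using cι 1
  have hpt : ∀ U : UGroup n, τ (∑ a, ∑ b, ((K (single b a 1) U - B (single b a 1) U)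
      * ι (single a b 1 * (U : Matrix n n ℂ))
        + f U * ι (single a b 1 * single b a 1 * (U : Matrix n n ℂ))))
      = τ (Kt U * ι U) - τ (Bt U) + (Fintype.card n : ℂ) * τ (f U * ι U) := by
    intro U
    rw [hK, hB]
    simp only [map_sum, map_add, sub_mul, map_sub, Finset.sum_add_distrib, Finset.sum_sub_distrib,
      hτ (B _ U), Finset.sum_mul]
    congr 2
    · simp [mul_assoc]
    · simp only [single_mul_single_same, mul_one, Finset.sum_const, Finset.card_univ,
        ← Finset.smul_sum, ← map_sum, ← Finset.mul_sum, ← Finset.sum_mul, sum_single_diag, one_mul]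
      simp
  simp only [hpt] at hsum
  have i1 := hint (fun U => Kt U * ι U) (hcK.mul cι1)
  have i2 := hint Bt hcB
  have i3 := hint (fun U => f U * ι U) (cf.mul cι1)
  have i4 : Integrable (fun U => τ (Kt U * ι U) - τ (Bt U)) (haarU n) := i1.sub i2
  rw [integral_add i4 (i3.const_mul _), integral_sub i1 i2, integral_const_mul] at hsum
  linear_combination hsum

end Registers

/-! ### Quantitative bounds for integration by parts -/

section TwistBound

variable {n : Type} [Fintype n] [DecidableEq n] {A : Type*} [CStarAlgebra A]
  {ι κ : Matrix n n ℂ →⋆ₐ[ℂ] A}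

/-- `f` is bounded by `m`, and its contracted derivatives along `ι` are bounded by `b`. -/
def TwistBound (ι : Matrix n n ℂ →⋆ₐ[ℂ] A) (m b : ℝ) (f : UGroup n → A) : Prop :=
  (∀ U, ‖f U‖ ≤ m) ∧ ∃ Kt Bt, HasTwist ι f Kt Bt ∧ ∀ U, ‖Kt U‖ ≤ b ∧ ‖Bt U‖ ≤ b

theorem TwistBound.const (ι : Matrix n n ℂ →⋆ₐ[ℂ] A) {z : A} {m : ℝ} (hz : ‖z‖ ≤ m) :
    TwistBound ι m 0 (fun _ => z) :=
  ⟨fun _ => hz, _, _, .const ι z, by simp⟩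

theorem TwistBound.mono {m b b' : ℝ} {f : UGroup n → A} (hf : TwistBound ι m b f) (h : b ≤ b') :
    TwistBound ι m b' f := by
  obtain ⟨h1, Kt, Bt, h2, h3⟩ := hf
  exact ⟨h1, Kt, Bt, h2, fun U => ⟨(h3 U).1.trans h, (h3 U).2.trans h⟩⟩

theorem TwistBound.add {m b m' b' : ℝ} {f g : UGroup n → A} (hf : TwistBound ι m b f)
    (hg : TwistBound ι m' b' g) : TwistBound ι (m + m') (b + b') (fun U => f U + g U) := by
  obtain ⟨h1, Kt, Bt, h2, h3⟩ := hf
  obtain ⟨h1', Kt', Bt', h2', h3'⟩ := hg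
  exact ⟨fun U => norm_add_le_of_le (h1 U) (h1' U), _, _, h2.add h2',
    fun U => ⟨norm_add_le_of_le (h3 U).1 (h3' U).1, norm_add_le_of_le (h3 U).2 (h3' U).2⟩⟩

/-- A contraction of `A` that commutes with the register `ι`. -/
structure IsStep (ι : Matrix n n ℂ →⋆ₐ[ℂ] A) (L : A →L[ℂ] A) : Prop where
  norm_le : ∀ x, ‖L x‖ ≤ ‖x‖
  map_mul_register : ∀ x X, L (x * ι X) = L x * ι X
  map_register_mul : ∀ x X, L (ι X * x) = ι X * L x

theorem norm_mul_le_of_left {x y : A} {c : ℝ} (hx : ‖x‖ ≤ 1) (hy : ‖y‖ ≤ c) : ‖x * y‖ ≤ c := by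
  refine (norm_mul_le x y).trans ((mul_le_mul hx hy (norm_nonneg _) zero_le_one).trans ?_)
  rw [one_mul]

theorem norm_mul_le_of_right {x y : A} {c : ℝ} (hx : ‖x‖ ≤ c) (hy : ‖y‖ ≤ 1) : ‖x * y‖ ≤ c := by
  refine (norm_mul_le x y).trans
    ((mul_le_mul hx hy (norm_nonneg _) ((norm_nonneg _).trans hx)).trans ?_)
  rw [mul_one]

theorem isStep_mulLeft {c : A} (hc : ‖c‖ ≤ 1) (h : ∀ X, Commute (ι X) c) :
    IsStep ι (ContinuousLinearMap.mul ℂ A c) where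
  norm_le x := norm_mul_le_of_left hc le_rfl
  map_mul_register x X := by simp [mul_assoc]
  map_register_mul x X := by simp [← mul_assoc, (h X).eq]

theorem isStep_mulRight {c : A} (hc : ‖c‖ ≤ 1) (h : ∀ X, Commute (ι X) c) :
    IsStep ι ((ContinuousLinearMap.mul ℂ A).flip c) where
  norm_le x := norm_mul_le_of_right le_rfl hc
  map_mul_register x X := by simp [mul_assoc, (h X).eq]
  map_register_mul x X := by simp [mul_assoc]

theorem TwistBound.map {m b : ℝ} {f : UGroup n → A} (hf : TwistBound ι m b f) {L : A →L[ℂ] A}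
    (hL : IsStep ι L) : TwistBound ι m b (fun U => L (f U)) := by
  obtain ⟨h1, Kt, Bt, h2, h3⟩ := hf
  exact ⟨fun U => (hL.norm_le _).trans (h1 U), _, _,
    h2.map L hL.map_mul_register hL.map_register_mul,
    fun U => ⟨(hL.norm_le _).trans (h3 U).1, (hL.norm_le _).trans (h3 U).2⟩⟩

/-- Gates and swaps are contractions: the bound `m` survives, and the single new swap term raises
`b` by `m`. -/
theorem TwistBound.mul_gate {m b : ℝ} {f : UGroup n → A} (hf : TwistBound ι m b f)
    (h : ∀ X Y, Commute (ι X) (κ Y)) : TwistBound ι m (b + m) (fun U => f U * κ U) := by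
  obtain ⟨h1, Kt, Bt, h2, h3⟩ := hf
  have hU := norm_register_unitary_le κ
  refine ⟨fun U => norm_mul_le_of_right (h1 U) (hU U), _, _, h2.mul_gate h, fun U => ⟨?_, ?_⟩⟩
  · exact norm_add_le_of_le (norm_mul_le_of_right (h3 U).1 (hU U))
      (norm_mul_le_of_right (norm_mul_le_of_right (h1 U) (norm_swapOp_le h)) (hU U))
  · have := (norm_nonneg _).trans (h1 U)
    linarith [norm_mul_le_of_right (h3 U).2 (hU U)]

theorem TwistBound.gate_mul {m b : ℝ} {f : UGroup n → A} (hf : TwistBound ι m b f)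
    (h : ∀ X Y, Commute (ι X) (κ Y)) :
    TwistBound ι m (b + m) (fun U => κ (star (U : Matrix n n ℂ)) * f U) := by
  obtain ⟨h1, Kt, Bt, h2, h3⟩ := hf
  have hU := norm_register_unitary_star_le κ
  refine ⟨fun U => norm_mul_le_of_left (hU U) (h1 U), _, _, h2.gate_mul h, fun U => ⟨?_, ?_⟩⟩
  · have := (norm_nonneg _).trans (h1 U)
    linarith [norm_mul_le_of_left (hU U) (h3 U).1]
  · exact norm_add_le_of_le (norm_mul_le_of_left (hU U) (h3 U).2)
      (norm_mul_le_of_left (norm_swapOp_le h) (h1 U))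

theorem norm_integral_haarU_le {f : UGroup n → ℂ} {c : ℝ} (h : ∀ U, ‖f U‖ ≤ c) :
    ‖∫ U, f U ∂haarU n‖ ≤ c := by
  simpa using norm_integral_le_of_norm_le_const (μ := haarU n) (Filter.Eventually.of_forall h)

/-- After integration by parts, the two contracted derivatives each contribute at most `T * b`. -/
theorem TwistBound.card_mul_norm_integral_le {m b T : ℝ} {f : UGroup n → A}
    (hf : TwistBound ι m b f) (τ : A →L[ℂ] ℂ) (hT : 0 ≤ T) (hτT : ∀ x, ‖τ x‖ ≤ T * ‖x‖)
    (hτ : ∀ x X, τ (x * ι X) = τ (ι X * x)) :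
    Fintype.card n * ‖∫ U, τ (f U * ι U) ∂haarU n‖ ≤ T * (2 * b) := by
  obtain ⟨h1, Kt, Bt, h2, h3⟩ := hf
  have h := congrArg norm (h2.integral τ hτ)
  rw [norm_mul, Complex.norm_natCast] at h
  rw [h]
  have hB : ‖∫ U, τ (Bt U) ∂haarU n‖ ≤ T * b := norm_integral_haarU_le fun U =>
    (hτT _).trans (mul_le_mul_of_nonneg_left (h3 U).2 hT)
  have hK : ‖∫ U, τ (Kt U * ι U) ∂haarU n‖ ≤ T * b := norm_integral_haarU_le fun U =>
    (hτT _).trans (mul_le_mul_of_nonneg_left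
      (norm_mul_le_of_right (h3 U).1 (norm_register_unitary_le ι U)) hT)
  refine (norm_sub_le_of_le hB hK).trans (le_of_eq (by ring))

end TwistBound

/-! ### Heisenberg evolution through the queries and the double integration by parts -/

section Heisenberg

variable {n : Type} [Fintype n] [DecidableEq n] {A : Type*} [CStarAlgebra A]

/-- Heisenberg evolution of the observable `Z` through rounds that consist of a query and of a
map `L k`. -/
noncomputable def heis (κ : Matrix n n ℂ →⋆ₐ[ℂ] A) (L : ℕ → A →L[ℂ] A) (Z : A) :
    ℕ → UGroup n → A
  | 0, _ => Z
  | k + 1, U => κ (star (U : Matrix n n ℂ)) * L k (heis κ L Z k U) * κ U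

/-- The sum of the evolutions in which one forward query is replaced with a swap with `ι`. -/
noncomputable def heisFwd (ι κ : Matrix n n ℂ →⋆ₐ[ℂ] A) (L : ℕ → A →L[ℂ] A) (Z : A) :
    ℕ → UGroup n → A
  | 0, _ => 0
  | k + 1, U => κ (star (U : Matrix n n ℂ)) * L k (heisFwd ι κ L Z k U) * κ U
      + κ (star (U : Matrix n n ℂ)) * L k (heis κ L Z k U) * swapOp ι κ * κ U

/-- The sum of the evolutions in which one backward query is replaced with a swap with `ι`. -/
noncomputable def heisBwd (ι κ : Matrix n n ℂ →⋆ₐ[ℂ] A) (L : ℕ → A →L[ℂ] A) (Z : A) :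
    ℕ → UGroup n → A
  | 0, _ => 0
  | k + 1, U => κ (star (U : Matrix n n ℂ)) * L k (heisBwd ι κ L Z k U) * κ U
      + swapOp ι κ * L k (heis κ L Z k U) * κ U

variable {ι ε κ : Matrix n n ℂ →⋆ₐ[ℂ] A} {L : ℕ → A →L[ℂ] A} {Z : A}

theorem hasTwist_heis (h : ∀ X Y, Commute (ι X) (κ Y)) (hL : ∀ k, IsStep ι (L k)) (Z : A) (k : ℕ) :
    HasTwist ι (heis κ L Z k) (heisFwd ι κ L Z k) (heisBwd ι κ L Z k) := by
  induction k with
  | zero => exact HasTwist.const ι Z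
  | succ k ih =>
    have := ((ih.map (L k) (hL k).map_mul_register (hL k).map_register_mul).gate_mul h).mul_gate h
    simp only [add_mul] at this
    exact this

theorem norm_heis_le (hL : ∀ k, IsStep ι (L k)) (hZ : ‖Z‖ ≤ 1) (k : ℕ) (U : UGroup n) :
    ‖heis κ L Z k U‖ ≤ 1 := by
  induction k with
  | zero => exact hZ
  | succ k ih =>
    exact norm_mul_le_of_right (norm_mul_le_of_left (norm_register_unitary_star_le κ U)
      (((hL k).norm_le _).trans ih)) (norm_register_unitary_le κ U)

theorem star_heis (hs : ∀ k x, L k (star x) = star (L k x)) (Z : A) (k : ℕ) (U : UGroup n) :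
    star (heis κ L Z k U) = heis κ L (star Z) k U := by
  induction k with
  | zero => rfl
  | succ k ih => simp only [heis, star_mul, ← ih, hs, ← map_star, star_star, mul_assoc]

/-- Each round has two gates, `U†` on the left and `U` on the right, and each costs one swap term of
norm at most one. -/
theorem twistBound_heis (h : ∀ X Y, Commute (ι X) (κ Y)) (hL : ∀ k, IsStep ι (L k))
    (hZ : ‖Z‖ ≤ 1) (k : ℕ) : TwistBound ι 1 (2 * k) (heis κ L Z k) := by
  induction k with
  | zero => exact (TwistBound.const ι hZ).mono (by simp)
  | succ k ih =>
    refine (((ih.map (hL k)).gate_mul h).mul_gate h).mono ?_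
    push_cast
    linarith

theorem commute_swapOp (h1 : ∀ X Y, Commute (ε X) (ι Y)) (h2 : ∀ X Y, Commute (ε X) (κ Y))
    (X : Matrix n n ℂ) : Commute (ε X) (swapOp ι κ) :=
  Commute.sum_right _ _ _ fun _ _ => Commute.sum_right _ _ _ fun _ _ =>
    (h1 _ _).mul_right (h2 _ _)

/-- Prepares the second integration by parts, along `ε`. The adjoint is taken because the factor
left over there is `U†`, while `HasTwist.integral` treats a factor `U`. The swap of `ι` and `κ`
commutes with `ε` and so counts as a step. -/
theorem twistBound_star_heisFwd (hει : ∀ X Y, Commute (ε X) (ι Y))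
    (hεκ : ∀ X Y, Commute (ε X) (κ Y)) (hικ : ∀ X Y, Commute (ι X) (κ Y))
    (hL : ∀ k, IsStep ε (L k)) (hs : ∀ k x, L k (star x) = star (L k x)) (hZ : ‖Z‖ ≤ 1) (k : ℕ) :
    TwistBound ε k (2 * k ^ 2) (fun U => star (heisFwd ι κ L Z k U)) := by
  induction k with
  | zero => simpa [heisFwd] using TwistBound.const ε (z := 0) (m := 0) (by simp)
  | succ k ih =>
    have hF := isStep_mulLeft (norm_swapOp_le hικ) (commute_swapOp hει hεκ)
    -- The old terms give `2k² + 2k`, as two gates each cost `k`. The term with the new swap gives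
    -- `2k + 2`. The sum is `2 (k + 1)²`.
    have h1 := ((ih.map (hL k)).gate_mul hεκ).mul_gate hεκ
    have h2 := (((((twistBound_heis hεκ hL (Z := star Z) (by rwa [norm_star]) k).map
      (hL k)).map hF).gate_mul hεκ).mul_gate hεκ)
    have h3 := h1.add h2
    convert h3.mono (b' := 2 * ((k + 1 : ℕ) : ℝ) ^ 2) (by push_cast; nlinarith) using 1
    · push_cast; ring
    · ext U
      simp only [heisFwd, star_add, star_mul, ← hs, star_heis hs, ← map_star, star_star,
        star_swapOp hικ, mul_assoc, ContinuousLinearMap.mul_apply']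

theorem twistBound_star_heisBwd (hει : ∀ X Y, Commute (ε X) (ι Y))
    (hεκ : ∀ X Y, Commute (ε X) (κ Y)) (hικ : ∀ X Y, Commute (ι X) (κ Y))
    (hL : ∀ k, IsStep ε (L k)) (hs : ∀ k x, L k (star x) = star (L k x)) (hZ : ‖Z‖ ≤ 1) (k : ℕ) :
    TwistBound ε k (2 * k ^ 2) (fun U => star (heisBwd ι κ L Z k U)) := by
  induction k with
  | zero => simpa [heisBwd] using TwistBound.const ε (z := 0) (m := 0) (by simp)
  | succ k ih =>
    have hF := isStep_mulRight (norm_swapOp_le hικ) (commute_swapOp hει hεκ)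
    have h1 := ((ih.map (hL k)).gate_mul hεκ).mul_gate hεκ
    -- Here the swap has consumed one of the two gates, so this term costs only `2k + 1`; the final
    -- bound is not sharp.
    have h2 := (((twistBound_heis hεκ hL (Z := star Z) (by rwa [norm_star]) k).map
      (hL k)).gate_mul hεκ).map hF
    have h3 := h1.add h2
    convert h3.mono (b' := 2 * ((k + 1 : ℕ) : ℝ) ^ 2) (by push_cast; nlinarith) using 1
    · push_cast; ring
    · ext U
      simp only [heisBwd, star_add, star_mul, ← hs, star_heis hs, ← map_star, star_star,
        star_swapOp hικ, mul_assoc, ContinuousLinearMap.flip_apply, ContinuousLinearMap.mul_apply']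

theorem norm_integral_star (τ : A →L[ℂ] ℂ) (hτ : ∀ x, τ (star x) = star (τ x)) (f : UGroup n → A) :
    ‖∫ U, τ (f U) ∂haarU n‖ = ‖∫ U, τ (star (f U)) ∂haarU n‖ := by
  have := integral_conj (μ := haarU n) (f := fun U => τ (f U))
  simp only [hτ, Complex.star_def, this, RCLike.norm_conj]

/-- After `q` queries, the correlation of the evolved observable with one extra use of `U` on
the register `ι` and one of `U†` on the register `ε` is of lower order. -/
theorem norm_integral_heis_le (hει : ∀ X Y, Commute (ε X) (ι Y))
    (hεκ : ∀ X Y, Commute (ε X) (κ Y)) (hικ : ∀ X Y, Commute (ι X) (κ Y))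
    (hLι : ∀ k, IsStep ι (L k)) (hLε : ∀ k, IsStep ε (L k))
    (hs : ∀ k x, L k (star x) = star (L k x)) (hZ : ‖Z‖ ≤ 1)
    (τ : A →L[ℂ] ℂ) {T : ℝ} (hT : 0 ≤ T) (hτT : ∀ x, ‖τ x‖ ≤ T * ‖x‖)
    (hτs : ∀ x, τ (star x) = star (τ x)) (hτι : ∀ x X, τ (x * ι X) = τ (ι X * x))
    (hτε : ∀ x X, τ (x * ε X) = τ (ε X * x)) (q : ℕ) :
    (Fintype.card n : ℝ) ^ 2 *
        ‖∫ U, τ (ε (star (U : Matrix n n ℂ)) * heis κ L Z q U * ι U) ∂haarU n‖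
      ≤ T * (Fintype.card n + 8 * q ^ 2 + 2 * q) := by
  have hιε : ∀ X Y, Commute (ι X) (ε Y) := fun X Y => (hει Y X).symm
  have hF := hasTwist_heis hικ hLι Z q
  -- First integration by parts, along `ι`. It leaves one term for the queries' factors `U†`, one
  -- for their factors `U`, and the swap of `ι` with `ε` coming from the extra `U†`.
  have hmain := (hF.gate_mul hιε).integral τ hτι
  have hB : TwistBound ε q (2 * q ^ 2) (fun U => star (heisBwd ι κ L Z q U)) :=
    twistBound_star_heisBwd hει hεκ hικ hLε hs hZ q
  -- Unlike the backward term, this one still has its factor on `ι`. That gate costs `q` more, which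
  -- is the source of `2 * q` in the conclusion.
  have hK := (twistBound_star_heisFwd hει hεκ hικ hLε hs hZ q).gate_mul hει
  have hB1 := hB.card_mul_norm_integral_le τ hT hτT hτε
  have hK1 := hK.card_mul_norm_integral_le τ hT hτT hτε
  have hB2 : ‖∫ U, τ (star (heisBwd ι κ L Z q U) * ε U) ∂haarU n‖
      = ‖∫ U, τ (ε (star (U : Matrix n n ℂ)) * heisBwd ι κ L Z q U) ∂haarU n‖ := by
    rw [norm_integral_star τ hτs]
    simp [← map_star]
  have hK2 : ‖∫ U, τ (ι (star (U : Matrix n n ℂ)) * star (heisFwd ι κ L Z q U) * ε U) ∂haarU n‖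
      = ‖∫ U, τ (ε (star (U : Matrix n n ℂ)) * heisFwd ι κ L Z q U * ι U) ∂haarU n‖ := by
    rw [norm_integral_star τ hτs]
    simp [← map_star, mul_assoc]
  rw [hB2] at hB1
  rw [hK2] at hK1
  have hZ1 : ‖∫ U, τ (swapOp ι ε * heis κ L Z q U) ∂haarU n‖ ≤ T :=
    norm_integral_haarU_le fun U => (hτT _).trans (mul_le_of_le_one_right hT
      (norm_mul_le_of_left (norm_swapOp_le hιε) (norm_heis_le hLι hZ q U)))
  have hcB : Continuous (heisBwd ι κ L Z q) := by
    obtain ⟨_, _, _, hc, _⟩ := hB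
    simpa using hc.1.star
  have i1 : Integrable (fun U : UGroup n =>
      τ (ε (star (U : Matrix n n ℂ)) * heisBwd ι κ L Z q U)) (haarU n) :=
    integrable_of_continuous (τ.continuous.comp (((continuous_register ε).comp
      continuous_subtype_val.star).mul hcB))
  have i2 : Integrable (fun U => τ (swapOp ι ε * heis κ L Z q U)) (haarU n) :=
    integrable_of_continuous (τ.continuous.comp (continuous_const.mul hF.1))
  simp only [map_add] at hmain
  rw [integral_add i1 i2] at hmain
  have hmain' := congrArg norm hmain
  rw [norm_mul, Complex.norm_natCast] at hmain'
  have h3 := norm_sub_le_of_le (norm_add_le_of_le le_rfl hZ1) le_rfl |>.trans' hmain'.le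
  have hn : (0 : ℝ) ≤ Fintype.card n := Nat.cast_nonneg _
  have h4 := mul_le_mul_of_nonneg_left h3 hn
  nlinarith

end Heisenberg

/-! ### Tensor factors as registers, and norm bounds for matrices -/

section Kronecker

variable {a b c : Type} [Fintype a] [DecidableEq a] [Fintype b] [DecidableEq b] [Fintype c]
  [DecidableEq c]

/-- `X ↦ X ⊗ 1`. -/
def leftReg (a b : Type) [Fintype a] [DecidableEq a] [Fintype b] [DecidableEq b] :
    Matrix a a ℂ →⋆ₐ[ℂ] Matrix (a × b) (a × b) ℂ where
  toFun X := X ⊗ₖ 1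
  map_one' := one_kronecker_one
  map_mul' X Y := by rw [← mul_kronecker_mul, mul_one]
  map_zero' := zero_kronecker _
  map_add' X Y := add_kronecker _ _ _
  commutes' r := by
    rw [Algebra.algebraMap_eq_smul_one, Algebra.algebraMap_eq_smul_one, smul_kronecker,
      one_kronecker_one]
  map_star' X := by simp [star_eq_conjTranspose, conjTranspose_kronecker]

/-- `X ↦ 1 ⊗ X`. -/
def rightReg (a b : Type) [Fintype a] [DecidableEq a] [Fintype b] [DecidableEq b] :
    Matrix b b ℂ →⋆ₐ[ℂ] Matrix (a × b) (a × b) ℂ where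
  toFun X := 1 ⊗ₖ X
  map_one' := one_kronecker_one
  map_mul' X Y := by rw [← mul_kronecker_mul, mul_one]
  map_zero' := kronecker_zero _
  map_add' X Y := kronecker_add _ _ _
  commutes' r := by
    rw [Algebra.algebraMap_eq_smul_one, Algebra.algebraMap_eq_smul_one, kronecker_smul,
      one_kronecker_one]
  map_star' X := by simp [star_eq_conjTranspose, conjTranspose_kronecker]

theorem leftReg_apply (X : Matrix a a ℂ) : leftReg a b X = X ⊗ₖ 1 := rfl

theorem rightReg_apply (X : Matrix b b ℂ) : rightReg a b X = 1 ⊗ₖ X := rfl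

theorem commute_leftReg_rightReg (X : Matrix a a ℂ) (Y : Matrix b b ℂ) :
    Commute (leftReg a b X) (rightReg a b Y) := by
  simp [Commute, SemiconjBy, leftReg_apply, rightReg_apply, ← mul_kronecker_mul]

/-- Stinespring dilation: stacking the `V k` gives an isometry `W`, and the sum is `W† (1 ⊗ Z) W`.
-/
theorem norm_sum_conj_le {ι : Type} [Fintype ι] (V : ι → Matrix b a ℂ)
    (hV : ∑ k, (V k)ᴴ * V k = 1) (Z : Matrix b b ℂ) : ‖∑ k, (V k)ᴴ * Z * V k‖ ≤ ‖Z‖ := by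
  classical
  let W : Matrix (ι × b) a ℂ := Matrix.of fun p j => V p.1 p.2 j
  have h1 : ∑ k, (V k)ᴴ * Z * V k = Wᴴ * rightReg ι b Z * W := by
    ext i j
    simp only [Matrix.sum_apply, Matrix.mul_apply, conjTranspose_apply, Fintype.sum_prod_type,
      rightReg_apply, kroneckerMap_apply, W, of_apply, one_apply, ite_mul, one_mul, zero_mul,
      mul_ite, mul_zero]
    refine Finset.sum_congr rfl fun k _ => Finset.sum_congr rfl fun y _ => ?_
    congr 1
    rw [Finset.sum_eq_single k (fun k' _ hk' => by simp [hk']) (by simp)]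
    simp
  have h2 : Wᴴ * W = 1 := by
    rw [← hV]
    ext i j
    simp [Matrix.sum_apply, Matrix.mul_apply, Fintype.sum_prod_type, W]
  have h3 : ‖W‖ ≤ 1 := by
    have := l2_opNorm_conjTranspose_mul_self W
    rw [h2] at this
    have h4 : ‖(1 : Matrix a a ℂ)‖ ≤ 1 := by
      simpa using norm_register_unitary_le (StarAlgHom.id ℂ (Matrix a a ℂ)) 1
    nlinarith [norm_nonneg W]
  have h4 : ‖rightReg ι b Z‖ ≤ ‖Z‖ := NonUnitalStarAlgHom.norm_apply_le _ _
  rw [h1]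
  calc ‖Wᴴ * rightReg ι b Z * W‖ ≤ ‖Wᴴ * rightReg ι b Z‖ * ‖W‖ := l2_opNorm_mul _ _
    _ ≤ ‖Wᴴ‖ * ‖rightReg ι b Z‖ * ‖W‖ := by gcongr; exact l2_opNorm_mul _ _
    _ ≤ 1 * ‖Z‖ * 1 := by rw [l2_opNorm_conjTranspose]; gcongr
    _ = ‖Z‖ := by ring

open scoped MatrixOrder in
/-- A state is a contractive functional on matrices, up to its trace. -/
theorem norm_trace_mul_posSemidef_le (x : Matrix a a ℂ) {ρ : Matrix a a ℂ} (hρ : ρ.PosSemidef) :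
    ‖(x * ρ).trace‖ ≤ ρ.trace.re * ‖x‖ := by
  obtain ⟨B, rfl⟩ := CStarAlgebra.nonneg_iff_eq_star_mul_self.mp hρ.nonneg
  rw [star_eq_conjTranspose]
  -- With `ρ = B† B`, the conjugated rows of `B` split `ρ` into rank-one terms; Cauchy–Schwarz is
  -- applied to each.
  let v : a → EuclideanSpace ℂ a := fun i => WithLp.toLp 2 fun j => star (B i j)
  have h1 : (x * (Bᴴ * B)).trace
      = ∑ i, inner ℂ (v i) (toEuclideanCLM (n := a) (𝕜 := ℂ) x (v i)) := by
    rw [← mul_assoc, trace_mul_comm]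
    simp only [trace, diag_apply, Matrix.mul_apply, PiLp.inner_apply, RCLike.inner_apply, v,
      ofLp_toEuclideanCLM, mulVec, dotProduct, conjTranspose_apply]
    refine Finset.sum_congr rfl fun i _ => Finset.sum_congr rfl fun j _ => ?_
    simp [mul_comm]
  have h2 : ((Bᴴ * B).trace).re = ∑ i, ‖v i‖ ^ 2 := by
    rw [trace_mul_comm]
    simp only [trace, diag_apply, Matrix.mul_apply, EuclideanSpace.norm_sq_eq, v,
      conjTranspose_apply, Complex.re_sum]
    refine Finset.sum_congr rfl fun i _ => Finset.sum_congr rfl fun j _ => ?_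
    simp [Complex.mul_conj, Complex.normSq_eq_norm_sq]
    norm_cast
  rw [h1, h2, Finset.sum_mul]
  refine norm_sum_le_of_le _ fun i _ => ?_
  calc _ ≤ ‖v i‖ * ‖toEuclideanCLM (n := a) (𝕜 := ℂ) x (v i)‖ := norm_inner_le_norm _ _
    _ ≤ ‖v i‖ * (‖x‖ * ‖v i‖) := by
      gcongr
      exact ContinuousLinearMap.le_opNorm _ _
    _ = _ := by ring

end Kronecker

/-! ### Adjoints of channels -/

section ChannelAdjoint

variable {a b : Type} [Fintype a] [DecidableEq a] [Fintype b]

/-- The adjoint of the channel `id ⊗ Λ`. -/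
noncomputable def Channel.adj (Λ : Channel a b) (c : Type) [Fintype c] [DecidableEq c] :
    Matrix (c × b) (c × b) ℂ →ₗ[ℂ] Matrix (c × a) (c × a) ℂ where
  toFun Z := ∑ k, ((1 : Matrix c c ℂ) ⊗ₖ Λ.kraus k)ᴴ * Z * ((1 : Matrix c c ℂ) ⊗ₖ Λ.kraus k)
  map_add' X Y := by simp only [Matrix.mul_add, Matrix.add_mul, Finset.sum_add_distrib]
  map_smul' r X := by
    simp only [Matrix.mul_smul, Matrix.smul_mul, ← Finset.smul_sum, RingHom.id_apply]

variable (Λ : Channel a b) {c : Type} [Fintype c] [DecidableEq c]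

theorem Channel.adj_apply (Z : Matrix (c × b) (c × b) ℂ) : Λ.adj c Z
    = ∑ k, ((1 : Matrix c c ℂ) ⊗ₖ Λ.kraus k)ᴴ * Z * ((1 : Matrix c c ℂ) ⊗ₖ Λ.kraus k) := rfl

theorem Channel.norm_adj_le [DecidableEq b] (Z : Matrix (c × b) (c × b) ℂ) : ‖Λ.adj c Z‖ ≤ ‖Z‖ := by
  refine norm_sum_conj_le _ ?_ Z
  simp only [conjTranspose_kronecker, conjTranspose_one, ← mul_kronecker_mul, mul_one]
  ext ⟨i, i'⟩ ⟨j, j'⟩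
  have := congrFun (congrFun Λ.tracePreserving i') j'
  rw [Matrix.sum_apply] at this
  simp only [Matrix.sum_apply, kroneckerMap_apply, ← Finset.mul_sum, this]
  simp [one_apply, ← ite_and, and_comm]

theorem Channel.adj_star (Z : Matrix (c × b) (c × b) ℂ) : Λ.adj c (star Z) = star (Λ.adj c Z) := by
  simp [Channel.adj_apply, star_eq_conjTranspose, Matrix.mul_assoc]

theorem Channel.adj_mul_left [DecidableEq b] (Z : Matrix (c × b) (c × b) ℂ) (X : Matrix c c ℂ) :
    Λ.adj c (Z * (X ⊗ₖ 1)) = Λ.adj c Z * (X ⊗ₖ 1) := by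
  simp only [Channel.adj_apply, Finset.sum_mul, Matrix.mul_assoc, ← mul_kronecker_mul,
    Matrix.mul_one, Matrix.one_mul]

theorem Channel.adj_left_mul [DecidableEq b] (Z : Matrix (c × b) (c × b) ℂ) (X : Matrix c c ℂ) :
    Λ.adj c ((X ⊗ₖ 1) * Z) = (X ⊗ₖ 1) * Λ.adj c Z := by
  simp only [Channel.adj_apply, Finset.mul_sum, ← Matrix.mul_assoc, conjTranspose_kronecker,
    conjTranspose_one, ← mul_kronecker_mul, Matrix.mul_one, Matrix.one_mul]

theorem Channel.trace_mul_apply (Z : Matrix (c × b) (c × b) ℂ) (X : Matrix c c ℂ)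
    (ρ : Matrix a a ℂ) : (Z * (X ⊗ₖ Λ.apply ρ)).trace = (Λ.adj c Z * (X ⊗ₖ ρ)).trace := by
  have h : X ⊗ₖ Λ.apply ρ = ∑ k, ((1 : Matrix c c ℂ) ⊗ₖ Λ.kraus k) * (X ⊗ₖ ρ)
      * ((1 : Matrix c c ℂ) ⊗ₖ Λ.kraus k)ᴴ := by
    simp only [conjTranspose_kronecker, conjTranspose_one, ← mul_kronecker_mul, Matrix.mul_one,
      Matrix.one_mul]
    ext ⟨i, i'⟩ ⟨j, j'⟩
    simp [Channel.apply, Matrix.sum_apply, Finset.mul_sum]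
  rw [h, Channel.adj_apply]
  simp only [Finset.mul_sum, Finset.sum_mul, trace_sum]
  refine Finset.sum_congr rfl fun k _ => ?_
  rw [← Matrix.mul_assoc, trace_mul_comm]
  simp only [Matrix.mul_assoc]

end ChannelAdjoint

/-! ### Passing from Eve's database to a Heisenberg observable -/

section Queries

variable {d N : ℕ}

/-- The swap of the two factors of `ℂ^n ⊗ ℂ^n`. -/
noncomputable def swapMat (n : Type) [Fintype n] [DecidableEq n] : Matrix (n × n) (n × n) ℂ :=
  swapOp (leftReg n n) (rightReg n n)

namespace Eve

variable (A : Eve d N)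

/-- The register of the challenge. -/
noncomputable def regC : Matrix (Bits d) (Bits d) ℂ →⋆ₐ[ℂ]
    Matrix ((Bits d × Bits d) × (Bits d × Fin A.workDim))
      ((Bits d × Bits d) × (Bits d × Fin A.workDim)) ℂ :=
  (leftReg (Bits d × Bits d) (Bits d × Fin A.workDim)).comp (leftReg (Bits d) (Bits d))

/-- The register of the state sent with the challenge. -/
noncomputable def regE : Matrix (Bits d) (Bits d) ℂ →⋆ₐ[ℂ]
    Matrix ((Bits d × Bits d) × (Bits d × Fin A.workDim))
      ((Bits d × Bits d) × (Bits d × Fin A.workDim)) ℂ :=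
  (leftReg (Bits d × Bits d) (Bits d × Fin A.workDim)).comp (rightReg (Bits d) (Bits d))

/-- The register of the queries. -/
noncomputable def regQ : Matrix (Bits d) (Bits d) ℂ →⋆ₐ[ℂ]
    Matrix ((Bits d × Bits d) × (Bits d × Fin A.workDim))
      ((Bits d × Bits d) × (Bits d × Fin A.workDim)) ℂ :=
  (rightReg (Bits d × Bits d) (Bits d × Fin A.workDim)).comp (leftReg (Bits d) (Fin A.workDim))

/-- The adjoint of Eve's step between the queries, counted from the last query. -/
noncomputable def adjStep (k : ℕ) :
    Matrix ((Bits d × Bits d) × (Bits d × Fin A.workDim))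
      ((Bits d × Bits d) × (Bits d × Fin A.workDim)) ℂ →L[ℂ]
    Matrix ((Bits d × Bits d) × (Bits d × Fin A.workDim))
      ((Bits d × Bits d) × (Bits d × Fin A.workDim)) ℂ :=
  LinearMap.toContinuousLinearMap ((A.step (A.queries - 1 - k)).adj (Bits d × Bits d))

theorem adjStep_apply (k : ℕ) (Z) :
    A.adjStep k Z = (A.step (A.queries - 1 - k)).adj (Bits d × Bits d) Z := rfl

theorem isStep_regC (k : ℕ) : IsStep A.regC (A.adjStep k) where
  norm_le := Channel.norm_adj_le _
  map_mul_register _ _ := Channel.adj_mul_left _ _ _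
  map_register_mul _ _ := Channel.adj_left_mul _ _ _

theorem isStep_regE (k : ℕ) : IsStep A.regE (A.adjStep k) where
  norm_le := Channel.norm_adj_le _
  map_mul_register _ _ := Channel.adj_mul_left _ _ _
  map_register_mul _ _ := Channel.adj_left_mul _ _ _

/-- Moves the last `k` queries from the state to the observable. The adjoint steps are therefore
numbered from the last query; the truncated subtraction in `adjStep` is harmless because only
indices below `queries` occur. -/
theorem trace_heis_mul_stateAfter (U : UGroup (Bits d)) (X : Matrix (Bits d × Bits d) _ ℂ) (Z)
    (k : ℕ) (hk : k ≤ A.queries) :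
    (heis A.regQ A.adjStep Z k U * (X ⊗ₖ A.stateAfter U (A.queries - k))).trace
      = (Z * (X ⊗ₖ A.stateAfter U A.queries)).trace := by
  induction k with
  | zero => rfl
  | succ k ih =>
    rw [← ih (by omega)]
    obtain ⟨m, hm⟩ : ∃ m, A.queries - k = m + 1 := ⟨A.queries - k - 1, by omega⟩
    have hm1 : A.queries - (k + 1) = m := by omega
    have hm2 : A.queries - 1 - k = m := by omega
    rw [hm, hm1, stateAfter, Channel.trace_mul_apply, heis, adjStep_apply, hm2]
    have h : X ⊗ₖ (((U : Matrix (Bits d) (Bits d) ℂ) ⊗ₖ (1 : Matrix (Fin A.workDim) _ ℂ)) *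
        A.stateAfter U m * ((U : Matrix (Bits d) (Bits d) ℂ) ⊗ₖ (1 : Matrix (Fin A.workDim) _ ℂ))ᴴ)
        = A.regQ U * (X ⊗ₖ A.stateAfter U m) * A.regQ (star (U : Matrix (Bits d) (Bits d) ℂ)) := by
      simp [regQ, rightReg_apply, leftReg_apply, ← mul_kronecker_mul, star_eq_conjTranspose,
        conjTranspose_kronecker]
    rw [h, ← mul_assoc, trace_mul_comm _ (A.regQ (star (U : Matrix (Bits d) (Bits d) ℂ)))]
    simp only [mul_assoc]

theorem trace_mul_database (U : UGroup (Bits d)) (X : Matrix (Bits d × Bits d) _ ℂ)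
    (M : Matrix ((Bits d × Bits d) × (∀ i, Fin (A.memDim i))) _ ℂ) :
    (M * (X ⊗ₖ A.database U)).trace
      = (heis A.regQ A.adjStep (A.store.adj _ M) A.queries U * (X ⊗ₖ A.init)).trace := by
  rw [database, Channel.trace_mul_apply, ← trace_heis_mul_stateAfter A U X _ _ le_rfl]
  simp [stateAfter]

theorem norm_swapMat_le (n : Type) [Fintype n] [DecidableEq n] : ‖swapMat n‖ ≤ 1 :=
  norm_swapOp_le commute_leftReg_rightReg

/-- A bounded test on the database, the challenge and the other state hardly sees the
correlation between the last two. -/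
theorem norm_integral_trace_swap_le
    (M : Matrix ((Bits d × Bits d) × (∀ i, Fin (A.memDim i))) _ ℂ) (hM : ‖M‖ ≤ 1) :
    ‖∫ U : UGroup (Bits d), (M * ((swapMat (Bits d) *
        ((U : Matrix (Bits d) (Bits d) ℂ) ⊗ₖ star (U : Matrix (Bits d) (Bits d) ℂ)))
          ⊗ₖ A.database U)).trace ∂haarU (Bits d)‖
      ≤ 2 ^ d + 8 * A.queries ^ 2 + 2 * A.queries := by
  -- The swap and the final storing channel are absorbed into the observable, at no cost in norm.
  let Z := A.store.adj (Bits d × Bits d) (M * leftReg _ _ (swapMat (Bits d)))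
  have hZ : ‖Z‖ ≤ 1 := (Channel.norm_adj_le _ _).trans (norm_mul_le_of_left hM
    ((NonUnitalStarAlgHom.norm_apply_le _ _).trans (norm_swapMat_le _)))
  let R : Matrix ((Bits d × Bits d) × (Bits d × Fin A.workDim)) _ ℂ :=
    (1 : Matrix (Bits d × Bits d) (Bits d × Bits d) ℂ) ⊗ₖ A.init
  have hR : R.PosSemidef := PosSemidef.one.kronecker A.init_posSemidef
  let τ : Matrix ((Bits d × Bits d) × (Bits d × Fin A.workDim))
      ((Bits d × Bits d) × (Bits d × Fin A.workDim)) ℂ →L[ℂ] ℂ :=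
    LinearMap.toContinuousLinearMap (traceLinearMap _ ℂ ℂ ∘ₗ LinearMap.mulRight ℂ R)
  have hτ : ∀ x, τ x = (x * R).trace := fun x => rfl
  have hRt : R.trace.re = (Fintype.card (Bits d) : ℝ) ^ 2 := by
    rw [show R.trace = ((Fintype.card (Bits d) ^ 2 : ℕ) : ℂ) by
      simp [R, trace_kronecker, A.init_trace, sq], Complex.natCast_re, Nat.cast_pow]
  have hcomm : ∀ X, Commute (leftReg _ _ X) R := fun X => by
    simp [Commute, SemiconjBy, leftReg_apply, R, ← mul_kronecker_mul]
  have hcyc : ∀ x X, τ (x * leftReg _ _ X) = τ (leftReg _ _ X * x) := fun x X => by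
    rw [hτ, hτ, mul_assoc, (hcomm X).eq, ← mul_assoc, trace_mul_comm, mul_assoc]
  have hCQ : ∀ X Y, Commute (A.regC X) (A.regQ Y) := fun X Y => commute_leftReg_rightReg _ _
  have hEQ : ∀ X Y, Commute (A.regE X) (A.regQ Y) := fun X Y => commute_leftReg_rightReg _ _
  have hEC : ∀ X Y, Commute (A.regE X) (A.regC Y) := fun X Y =>
    ((commute_leftReg_rightReg Y X).symm).map (leftReg _ _)
  have key := norm_integral_heis_le (L := A.adjStep) (Z := Z) hEC hEQ hCQ A.isStep_regC
    A.isStep_regE (fun k x => Channel.adj_star _ x) hZ τ (T := (Fintype.card (Bits d) : ℝ) ^ 2)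
    (by positivity) (fun x => by rw [← hRt]; exact norm_trace_mul_posSemidef_le x hR)
    (fun x => by
      rw [hτ, hτ, star_eq_conjTranspose, ← trace_conjTranspose, conjTranspose_mul, hR.1.eq,
        trace_mul_comm])
    (fun x X => hcyc _ _) (fun x X => hcyc _ _) A.queries
  have hc : (Fintype.card (Bits d) : ℝ) = 2 ^ d := by simp
  rw [hc] at key
  -- The functional has norm at most `T = D²`, the trace of `1 ⊗ init`; this cancels exactly the
  -- `D²` gained from two integrations by parts.
  have key' := le_of_mul_le_mul_left key (by positivity)
  refine le_trans (le_of_eq ?_) key'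
  congr 2
  ext U
  have h1 : (M * ((swapMat (Bits d) * ((U : Matrix (Bits d) (Bits d) ℂ) ⊗ₖ
      star (U : Matrix (Bits d) (Bits d) ℂ))) ⊗ₖ A.database U))
      = (M * leftReg _ _ (swapMat (Bits d))) * (((U : Matrix (Bits d) (Bits d) ℂ) ⊗ₖ
      star (U : Matrix (Bits d) (Bits d) ℂ)) ⊗ₖ A.database U) := by
    rw [leftReg_apply, mul_assoc, ← mul_kronecker_mul, one_mul]
  rw [h1, trace_mul_database]
  have h2 : ((U : Matrix (Bits d) (Bits d) ℂ) ⊗ₖ star (U : Matrix (Bits d) (Bits d) ℂ)) ⊗ₖ A.init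
      = A.regC U * R * A.regE (star (U : Matrix (Bits d) (Bits d) ℂ)) := by
    simp [R, regC, regE, leftReg_apply, rightReg_apply, ← mul_kronecker_mul]
  rw [h2, hτ, ← mul_assoc, ← mul_assoc, trace_mul_comm]
  simp only [mul_assoc]
  rfl

end Eve

end Queries

/-! ### Second moments of a Haar-random unitary -/

section SecondMoment

variable {n : Type} [Fintype n] [DecidableEq n]

/-- The Haar average of `P` under `E ⊗ E`, seen through the linear functional `L`. -/
noncomputable def twirl (L : Matrix (n × n) (n × n) ℂ →ₗ[ℂ] ℂ) (P : Matrix (n × n) (n × n) ℂ) : ℂ :=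
  ∫ E : UGroup n, L (((E : Matrix n n ℂ) ⊗ₖ (E : Matrix n n ℂ)) * P *
    ((E : Matrix n n ℂ) ⊗ₖ (E : Matrix n n ℂ))ᴴ) ∂haarU n

variable (L : Matrix (n × n) (n × n) ℂ →ₗ[ℂ] ℂ)

theorem continuous_twirl (P : Matrix (n × n) (n × n) ℂ) :
    Continuous fun E : UGroup n => L (((E : Matrix n n ℂ) ⊗ₖ (E : Matrix n n ℂ)) * P *
      ((E : Matrix n n ℂ) ⊗ₖ (E : Matrix n n ℂ))ᴴ) := by
  have h : Continuous fun E : UGroup n => (E : Matrix n n ℂ) ⊗ₖ (E : Matrix n n ℂ) := by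
    refine continuous_matrix fun i j => ?_
    simp only [kroneckerMap_apply]
    exact (continuous_subtype_val.matrix_elem _ _).mul (continuous_subtype_val.matrix_elem _ _)
  exact (LinearMap.continuous_of_finiteDimensional L).comp
    ((h.matrix_mul continuous_const).matrix_mul h.matrix_conjTranspose)

theorem twirl_add (P Q : Matrix (n × n) (n × n) ℂ) : twirl L (P + Q) = twirl L P + twirl L Q := by
  simp only [twirl, mul_add, add_mul, map_add]
  exact integral_add (integrable_of_continuous (continuous_twirl L P))
    (integrable_of_continuous (continuous_twirl L Q))

theorem twirl_smul (c : ℂ) (P : Matrix (n × n) (n × n) ℂ) : twirl L (c • P) = c * twirl L P := by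
  simp only [twirl, mul_smul_comm, smul_mul_assoc, map_smul, smul_eq_mul, integral_const_mul]

/-- The twirl as a linear map. -/
noncomputable def twirlLM : Matrix (n × n) (n × n) ℂ →ₗ[ℂ] ℂ where
  toFun := twirl L
  map_add' := twirl_add L
  map_smul' := twirl_smul L

theorem twirlLM_apply (P : Matrix (n × n) (n × n) ℂ) : twirlLM L P = twirl L P := rfl

theorem twirl_conj (V : UGroup n) (P : Matrix (n × n) (n × n) ℂ) :
    twirl L (((V : Matrix n n ℂ) ⊗ₖ (V : Matrix n n ℂ)) * P *
      ((V : Matrix n n ℂ) ⊗ₖ (V : Matrix n n ℂ))ᴴ) = twirl L P := by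
  rw [twirl, twirl, ← integral_mul_right_eq_self (fun E : UGroup n => L
    (((E : Matrix n n ℂ) ⊗ₖ (E : Matrix n n ℂ)) * P *
      ((E : Matrix n n ℂ) ⊗ₖ (E : Matrix n n ℂ))ᴴ)) V]
  congr 1
  ext E
  congr 1
  simp only [Submonoid.coe_mul, mul_kronecker_mul, conjTranspose_mul, mul_assoc]

theorem twirl_of_comm (P : Matrix (n × n) (n × n) ℂ)
    (h : ∀ E : UGroup n, ((E : Matrix n n ℂ) ⊗ₖ (E : Matrix n n ℂ)) * P
      = P * ((E : Matrix n n ℂ) ⊗ₖ (E : Matrix n n ℂ))) : twirl L P = L P := by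
  have h1 : ∀ E : UGroup n, ((E : Matrix n n ℂ) ⊗ₖ (E : Matrix n n ℂ)) * P *
      ((E : Matrix n n ℂ) ⊗ₖ (E : Matrix n n ℂ))ᴴ = P := fun E => by
    have h2 : (E : Matrix n n ℂ) * (E : Matrix n n ℂ)ᴴ = 1 := Unitary.mul_star_self_of_mem E.2
    rw [h, mul_assoc, conjTranspose_kronecker, ← mul_kronecker_mul, h2, one_kronecker_one, mul_one]
  simp [twirl, h1]

theorem swapMat_eq : swapMat n = ∑ x, ∑ y, single x y (1 : ℂ) ⊗ₖ single y x (1 : ℂ) := by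
  simp [swapMat, swapOp, leftReg_apply, rightReg_apply, ← mul_kronecker_mul]

theorem kronecker_eq_reg (X Y : Matrix n n ℂ) : X ⊗ₖ Y = leftReg n n X * rightReg n n Y := by
  simp [leftReg_apply, rightReg_apply, ← mul_kronecker_mul]

theorem kronecker_mul_swapMat (X Y : Matrix n n ℂ) :
    (X ⊗ₖ Y) * swapMat n = swapMat n * (Y ⊗ₖ X) := by
  have h := commute_leftReg_rightReg (a := n) (b := n)
  rw [kronecker_eq_reg, kronecker_eq_reg, swapMat, mul_assoc, register_mul_swapOp' h, ← mul_assoc,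
    register_mul_swapOp, mul_assoc, (h Y X).eq]

theorem twirl_one : twirl L 1 = L 1 := twirl_of_comm L 1 fun _ => by simp

theorem twirl_swapMat : twirl L (swapMat n) = L (swapMat n) :=
  twirl_of_comm L _ fun _ => kronecker_mul_swapMat _ _

/-- The twirl annihilates the adjoint action of the Lie algebra. -/
theorem twirl_commutator (P : Matrix (n × n) (n × n) ℂ) (X : Matrix n n ℂ) :
    twirl L ((X ⊗ₖ 1 + 1 ⊗ₖ X) * P - P * (X ⊗ₖ 1 + 1 ⊗ₖ X)) = 0 := by
  let ad : Matrix n n ℂ →ₗ[ℂ] Matrix (n × n) (n × n) ℂ :=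
    { toFun := fun X => (X ⊗ₖ 1 + 1 ⊗ₖ X) * P - P * (X ⊗ₖ 1 + 1 ⊗ₖ X)
      map_add' := fun X Y => by
        simp only [add_kronecker, kronecker_add, add_mul, mul_add]
        abel
      map_smul' := fun c X => by
        simp only [smul_kronecker, kronecker_smul, ← smul_add, smul_mul_assoc, mul_smul_comm,
          smul_sub, RingHom.id_apply] }
  have h : twirlLM L ∘ₗ ad = 0 := linearMap_eq_zero_of_skew _ fun H => by
    rw [LinearMap.comp_apply, twirlLM_apply, twirl]
    refine integral_deriv_right_eq_zero H (continuous_twirl L P) (continuous_twirl L _) fun E => ?_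
    -- The curve is differentiated at the identity; `E ⊗ E` is then restored as a constant factor on
    -- both sides.
    have d1 := (hasDerivAt_register (leftReg n n) H 1).mul (hasDerivAt_register (rightReg n n) H 1)
    have d2 := ((d1.mul_const P).mul d1.star).const_mul
      ((E : Matrix n n ℂ) ⊗ₖ (E : Matrix n n ℂ)) |>.mul_const
        ((E : Matrix n n ℂ) ⊗ₖ (E : Matrix n n ℂ))ᴴ
    let L' : Matrix (n × n) (n × n) ℂ →L[ℂ] ℂ := LinearMap.toContinuousLinearMap L
    have d3 := (L'.restrictScalars ℝ).hasFDerivAt.comp_hasDerivAt (0 : ℝ) d2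
    refine (d3.congr_deriv ?_).congr_of_eventuallyEq (Filter.Eventually.of_forall fun s => ?_)
    · simp [L', ad, expCurve_zero, leftReg_apply, rightReg_apply, star_eq_conjTranspose,
        conjTranspose_kronecker]
      have hH : (H : Matrix n n ℂ)ᴴ = H := H.2.star_eq
      rw [hH, ← smul_eq_mul Complex.I, ← map_smul L, ← smul_mul_assoc, ← mul_smul_comm]
      congr 3
      simp only [smul_sub, smul_add, add_mul, mul_add, mul_neg, smul_mul_assoc, mul_smul_comm]
      abel
    · simp [L', ← kronecker_eq_reg, mul_kronecker_mul, mul_assoc, star_eq_conjTranspose]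
  exact LinearMap.congr_fun h X

/-- The permutation matrix of `π`, as a unitary. -/
def permU (π : Equiv.Perm n) : UGroup n :=
  ⟨Matrix.of fun i j => if π.symm i = j then 1 else 0, by
    rw [Matrix.mem_unitaryGroup_iff]
    ext i j
    simp [Matrix.mul_apply, star_eq_conjTranspose, one_apply, eq_comm]⟩

theorem permU_conj_single (π : Equiv.Perm n) (i j : n) :
    (permU π : Matrix n n ℂ) * single i j 1 * (permU π : Matrix n n ℂ)ᴴ = single (π i) (π j) 1 := by
  ext k l
  simp [permU, Matrix.mul_apply, single_apply, Equiv.eq_symm_apply]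
  by_cases h : π j = l <;> simp [h, Equiv.symm_apply_eq, eq_comm (a := k)]

theorem twirl_perm (π : Equiv.Perm n) (i j k l : n) :
    twirl L (single (π i) (π j) 1 ⊗ₖ single (π k) (π l) 1)
      = twirl L (single i j 1 ⊗ₖ single k l 1) := by
  rw [← twirl_conj L (permU π) (single i j 1 ⊗ₖ single k l 1), conjTranspose_kronecker,
    ← mul_kronecker_mul, ← mul_kronecker_mul, permU_conj_single, permU_conj_single]

/-- The first swap brings `x₀` to `x`; the second brings the image of `y₀` to `y` and fixes `x`,
which differs from both. -/
theorem exists_perm_pair {n : Type*} [DecidableEq n] {x₀ y₀ x y : n} (h₀ : x₀ ≠ y₀) (h : x ≠ y) :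
    ∃ π : Equiv.Perm n, π x₀ = x ∧ π y₀ = y := by
  refine ⟨Equiv.swap (Equiv.swap x₀ x y₀) y * Equiv.swap x₀ x, ?_, ?_⟩
  · have h1 : x ≠ Equiv.swap x₀ x y₀ := fun h' => h₀ <| by
      have := congrArg (Equiv.swap x₀ x) h'
      simpa using this
    simp [Equiv.swap_apply_of_ne_of_ne h1 h]
  · simp

/-- The commutator of `e_yx ⊗ 1 + 1 ⊗ e_yx` with `e_xx ⊗ e_xy` is `e_yx ⊗ e_xy + e_xx ⊗ e_yy - e_xx
⊗ e_xx`, and the twirl kills it. -/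
theorem twirl_triple {x y : n} (h : x ≠ y) :
    twirl L (single x x 1 ⊗ₖ single x x 1) = twirl L (single x x 1 ⊗ₖ single y y 1)
      + twirl L (single y x 1 ⊗ₖ single x y 1) := by
  have key := twirl_commutator L (single x x 1 ⊗ₖ single x y 1) (single y x 1)
  simp only [add_mul, mul_add, ← mul_kronecker_mul, one_mul, mul_one, single_mul_single_same,
    single_mul_single_of_ne _ _ _ _ h, zero_kronecker,
    zero_add] at key
  rw [← twirlLM_apply, map_sub, map_add] at key
  simp only [twirlLM_apply] at key
  linear_combination -key

theorem sum_sum_of_ne {f : n → n → ℂ} {a b : ℂ} (ha : ∀ x, f x x = a)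
    (hb : ∀ x y, x ≠ y → f x y = b) :
    ∑ x, ∑ y, f x y = Fintype.card n * a + Fintype.card n * (Fintype.card n - 1) * b := by
  have h : ∀ x, ∑ y, f x y = a + (Fintype.card n - 1) * b := by
    intro x
    rw [← Finset.add_sum_erase _ _ (Finset.mem_univ x), ha,
      Finset.sum_congr rfl fun y hy => hb x y (Finset.ne_of_mem_erase hy).symm]
    have : 1 ≤ Fintype.card n := Fintype.card_pos_iff.mpr ⟨x⟩
    simp [Finset.card_erase_of_mem, Nat.cast_sub this]
  simp [h]
  ring

/-- By permutation invariance three twirls are unknown: those of `e_xx ⊗ e_xx`, `e_xx ⊗ e_yy` and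
`e_yx ⊗ e_xy`. The fixed points `1` and `F` of the twirl give two linear equations and
`twirl_triple` gives the third. -/
theorem second_moment {x y : n} (h : x ≠ y) :
    (Fintype.card n : ℂ) * (Fintype.card n + 1) * twirl L (single x x 1 ⊗ₖ single x x 1)
      = L 1 + L (swapMat n) ∧
    (Fintype.card n : ℂ) * (Fintype.card n - 1) * twirl L (single x x 1 ⊗ₖ single y y 1)
      = L 1 - Fintype.card n * twirl L (single x x 1 ⊗ₖ single x x 1) := by
  have hF := twirl_swapMat L
  have h1 := twirl_one L
  have hone : (1 : Matrix (n × n) (n × n) ℂ)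
      = ∑ x, ∑ y, single x x (1 : ℂ) ⊗ₖ single y y (1 : ℂ) := by
    rw [← one_kronecker_one, ← sum_single_diag (n := n)]
    ext
    simp [Matrix.sum_apply, Finset.sum_mul_sum]
  have hF' : ∑ x, ∑ y, twirl L (single x y 1 ⊗ₖ single y x 1) = L (swapMat n) := by
    rw [← hF, swapMat_eq, ← twirlLM_apply]
    simp only [map_sum, twirlLM_apply]
  have h1' : ∑ x, ∑ y, twirl L (single x x 1 ⊗ₖ single y y 1) = L 1 := by
    rw [← h1, hone, ← twirlLM_apply]
    simp only [map_sum, twirlLM_apply]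
  have ha : ∀ z, twirl L (single z z 1 ⊗ₖ single z z 1)
      = twirl L (single x x 1 ⊗ₖ single x x 1) := fun z => by
    simpa using twirl_perm L (Equiv.swap x z) x x x x
  rw [sum_sum_of_ne (b := twirl L (single y x 1 ⊗ₖ single x y 1)) ha fun z w hzw => by
    obtain ⟨π, rfl, rfl⟩ := exists_perm_pair h.symm hzw
    exact twirl_perm L π _ _ _ _] at hF'
  rw [sum_sum_of_ne (b := twirl L (single x x 1 ⊗ₖ single y y 1)) ha fun z w hzw => by
    obtain ⟨π, rfl, rfl⟩ := exists_perm_pair h hzw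
    exact twirl_perm L π _ _ _ _] at h1'
  have h3 := twirl_triple L h
  constructor
  · rw [← hF', ← h1']
    linear_combination Fintype.card n * (Fintype.card n - 1) * h3
  · rw [← h1']
    ring

end SecondMoment

/-! ### Reduction of the output statistics to a single round -/

section Output

theorem norm_submatrix_le {a b : Type} [Fintype a] [DecidableEq a] [Fintype b] [DecidableEq b]
    (Z : Matrix b b ℂ) (e : a ≃ b) : ‖Z.submatrix e e‖ ≤ ‖Z‖ := by
  have h := norm_sum_conj_le (ι := Unit) (fun _ => (1 : Matrix b b ℂ).submatrix id e)
    (by ext i j; simp [Matrix.mul_apply, one_apply]) Z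
  convert h using 2
  ext i j
  simp [Matrix.mul_apply, one_apply]

/-- The observable that a channel with one output bit measures. -/
noncomputable def Channel.effect {a : Type} [Fintype a] [DecidableEq a] (Λ : Channel a Bool)
    (b : Bool) : Matrix a a ℂ :=
  ∑ k, (Λ.kraus k)ᴴ * (single b b (1 : ℂ) : Matrix Bool Bool ℂ) * Λ.kraus k

theorem Channel.effect_apply {a : Type} [Fintype a] [DecidableEq a] (Λ : Channel a Bool)
    (b : Bool) (s t : a) : Λ.effect b s t = ∑ k, star (Λ.kraus k b s) * Λ.kraus k b t := by
  simp only [Channel.effect, Matrix.sum_apply]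
  refine Finset.sum_congr rfl fun k _ => ?_
  simp [Matrix.mul_apply, single_apply, ite_and]

theorem Channel.sum_effect {a : Type} [Fintype a] [DecidableEq a] (Λ : Channel a Bool) :
    ∑ b, Λ.effect b = 1 := by
  rw [← Λ.tracePreserving]
  ext s t
  simp only [Matrix.sum_apply, Channel.effect_apply, Matrix.mul_apply, conjTranspose_apply]
  exact Finset.sum_comm

theorem Channel.norm_effect_le {a : Type} [Fintype a] [DecidableEq a] (Λ : Channel a Bool)
    (b : Bool) : ‖Λ.effect b‖ ≤ 1 := by
  refine (norm_sum_conj_le _ Λ.tracePreserving _).trans ?_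
  rw [← diagonal_single, l2_opNorm_diagonal]
  refine (pi_norm_le_iff_of_nonneg zero_le_one).mpr fun c => ?_
  rw [Pi.single_apply]
  split_ifs <;> simp

/-- The diagonal output probabilities of a product channel with bit outputs. -/
theorem Channel.pi_apply_diag {N : ℕ} {a : Fin N → Type} [∀ i, Fintype (a i)]
    [∀ i, DecidableEq (a i)] (Λ : ∀ i, Channel (a i) Bool) (ρ : Matrix (∀ i, a i) (∀ i, a i) ℂ)
    (S : Fin N → Bool) : (Channel.pi Λ).apply ρ S S
      = ∑ s, ∑ t, ρ s t * ∏ i, (Λ i).effect (S i) (t i) (s i) := by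
  have h : ∀ s t : ∀ i, a i, ∏ i, (Λ i).effect (S i) (t i) (s i)
      = ∑ k : ∀ i, (Λ i).ι, (∏ i, (Λ i).kraus (k i) (S i) (s i))
        * star (∏ i, (Λ i).kraus (k i) (S i) (t i)) := by
    intro s t
    simp only [Channel.effect_apply, Fintype.prod_sum, star_prod, ← Finset.prod_mul_distrib]
    refine Finset.sum_congr rfl fun k _ => Finset.prod_congr rfl fun i _ => mul_comm _ _
  simp only [h, Finset.mul_sum]
  simp only [Channel.apply, Matrix.sum_apply, Matrix.mul_apply, conjTranspose_apply,
    Finset.sum_mul]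
  rw [Finset.sum_comm]
  conv_rhs => rw [Finset.sum_comm]
  refine Finset.sum_congr rfl fun t _ => ?_
  rw [Finset.sum_comm]
  refine Finset.sum_congr rfl fun s _ => Finset.sum_congr rfl fun k _ => ?_
  simp only [Channel.pi, of_apply]
  ring

namespace Eve

variable {d N : ℕ} (A : Eve d N)

/-- The registers of round `i` against the rest of the database. -/
def splitRound (i : Fin N) : ((Bits d × Bits d) × (∀ j, Fin (A.memDim j))) ≃
    (RoundReg d (A.memDim i) × (∀ j : {j // j ≠ i}, Fin (A.memDim j))) :=
  ((Equiv.refl _).prodCongr (Equiv.piSplitAt i fun j => Fin (A.memDim j))).trans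
    ((Equiv.prodAssoc _ _ _).symm.trans ((Equiv.prodComm _ _).prodCongr (Equiv.refl _)))

theorem splitRound_apply (i : Fin N) (p) :
    A.splitRound i p = ((p.2 i, p.1), fun j : {j // j ≠ i} => p.2 j) := rfl

/-- The observable for the output bit of round `i`. -/
noncomputable def roundEffect (i : Fin N) (b : Bool) :
    Matrix ((Bits d × Bits d) × (∀ j, Fin (A.memDim j)))
      ((Bits d × Bits d) × (∀ j, Fin (A.memDim j))) ℂ :=
  (leftReg _ _ ((A.attack i).effect b)).submatrix (A.splitRound i) (A.splitRound i)

theorem norm_roundEffect_le (i : Fin N) (b : Bool) : ‖A.roundEffect i b‖ ≤ 1 :=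
  (norm_submatrix_le _ _).trans
    ((NonUnitalStarAlgHom.norm_apply_le _ _).trans (Channel.norm_effect_le _ _))

theorem sum_roundEffect (i : Fin N) : ∑ b, A.roundEffect i b = 1 := by
  have h : ∑ b, leftReg _ (∀ j : {j // j ≠ i}, Fin (A.memDim j)) ((A.attack i).effect b) = 1 := by
    rw [← map_sum, Channel.sum_effect, map_one]
  ext p q
  have := congrFun (congrFun h (A.splitRound i p)) (A.splitRound i q)
  rw [Matrix.sum_apply] at this ⊢
  simp only [roundEffect, submatrix_apply, this, one_apply, EmbeddingLike.apply_eq_iff_eq]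

/-- The form as a product over rounds matches the factorised effects of the product channel. -/
theorem roundEffect_apply (i : Fin N) (b : Bool) (p q) : A.roundEffect i b p q
    = ∏ j, if j = i then (A.attack i).effect b (p.2 i, p.1) (q.2 i, q.1)
        else if p.2 j = q.2 j then 1 else 0 := by
  rw [← Finset.mul_prod_erase _ _ (mem_univ i), if_pos rfl]
  have h : ∏ j ∈ univ.erase i, (if j = i then (A.attack i).effect b (p.2 i, p.1) (q.2 i, q.1)
      else if p.2 j = q.2 j then 1 else 0)
      = ∏ j ∈ univ.erase i, if p.2 j = q.2 j then (1 : ℂ) else 0 :=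
    Finset.prod_congr rfl fun j hj => if_neg (Finset.ne_of_mem_erase hj)
  rw [h, Finset.prod_ite_zero, roundEffect, submatrix_apply, leftReg_apply, kroneckerMap_apply,
    splitRound_apply, splitRound_apply, one_apply, Finset.prod_const_one]
  simp [funext_iff]

theorem sum_diag_proj {n : Type} [Fintype n] (v : n → ℂ) : ∑ s, proj v s s = star v ⬝ᵥ v := by
  simp [proj, vecMulVec_apply, dotProduct, mul_comm]

/-- This is where the attack being collective is used. Summing over the other output bits turns
their effects into identities; the unit vectors of those rounds then trace out to `1`, however
entangled the database is. -/
theorem outputBitProb_eq (U : UGroup (Bits d)) (c r : Fin N → Bits d → ℂ)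
    (hc : ∀ j, star (c j) ⬝ᵥ c j = 1) (hr : ∀ j, star (r j) ⬝ᵥ r j = 1) (i : Fin N) (b : Bool) :
    A.outputBitProb U c r i b
      = (A.roundEffect i b * ((proj (c i) ⊗ₖ proj (r i)) ⊗ₖ A.database U)).trace.re := by
  let g : ∀ j, RoundReg d (A.memDim j) → RoundReg d (A.memDim j) → ℂ := fun j t s =>
    if j = i then (A.attack j).effect b t s else if t = s then 1 else 0
  have h1 : ∀ s t : ∀ j, RoundReg d (A.memDim j),
      ∑ S : Fin N → Bool with S i = b, ∏ j, (A.attack j).effect (S j) (t j) (s j)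
        = ∏ j, g j (t j) (s j) := by
    intro s t
    -- The constraint on bit `i` is spread over the factors, so that the sum over `S` factorises.
    have hS : ∀ S : Fin N → Bool, (if S i = b then
        ∏ j, (A.attack j).effect (S j) (t j) (s j) else 0)
        = ∏ j, if (j = i → S j = b) then (A.attack j).effect (S j) (t j) (s j) else 0 := by
      intro S
      rw [Finset.prod_ite_zero]
      simp
    rw [Finset.sum_filter, Finset.sum_congr rfl fun S _ => hS S,
      ← Fintype.prod_sum fun j b' => if (j = i → b' = b) then
        (A.attack j).effect b' (t j) (s j) else 0]
    refine Finset.prod_congr rfl fun j _ => ?_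
    by_cases hj : j = i
    · simp [g, hj]
    · have := congrFun (congrFun (A.attack j).sum_effect (t j)) (s j)
      rw [Matrix.sum_apply, one_apply] at this
      simpa only [g, hj, false_imp_iff, if_true, if_false] using this
  have h2 : ∑ S : Fin N → Bool with S i = b,
      (Channel.pi A.attack).apply (A.roundsInput U c r) S S
      = ∑ s, ∑ t, A.roundsInput U c r s t * ∏ j, g j (t j) (s j) := by
    simp only [Channel.pi_apply_diag, ← h1, Finset.mul_sum]
    rw [Finset.sum_comm]
    refine Finset.sum_congr rfl fun s _ => ?_
    rw [Finset.sum_comm]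
  have h3 : ∀ μ ν : ∀ j, Fin (A.memDim j),
      ∑ σ : Fin N → Bits d × Bits d, ∑ σ' : Fin N → Bits d × Bits d, ∏ j,
        (proj (c j) (σ j).1 (σ' j).1 * proj (r j) (σ j).2 (σ' j).2
          * g j (ν j, σ' j) (μ j, σ j))
      = ∑ p, ∑ p', (proj (c i) ⊗ₖ proj (r i)) p p' * A.roundEffect i b (p', ν) (p, μ) := by
    intro μ ν
    have hout : ∀ j, j ≠ i → ∑ p : Bits d × Bits d, ∑ p' : Bits d × Bits d,
        (proj (c j) p.1 p'.1 * proj (r j) p.2 p'.2 * g j (ν j, p') (μ j, p))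
        = if ν j = μ j then 1 else 0 := by
      intro j hj
      have h1 : ∑ p : Bits d × Bits d, proj (c j) p.1 p.1 * proj (r j) p.2 p.2 = 1 := by
        rw [Fintype.sum_prod_type]
        simp only [← Finset.mul_sum, ← Finset.sum_mul, sum_diag_proj, hc, hr, one_mul]
      by_cases h : ν j = μ j
      · simpa [g, hj, h] using h1
      · simp [g, hj, h]
    have hprod : ∀ σ : Fin N → Bits d × Bits d, ∑ σ' : Fin N → Bits d × Bits d, ∏ j,
        (proj (c j) (σ j).1 (σ' j).1 * proj (r j) (σ j).2 (σ' j).2 * g j (ν j, σ' j) (μ j, σ j))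
        = ∏ j, ∑ p' : Bits d × Bits d, (proj (c j) (σ j).1 p'.1 * proj (r j) (σ j).2 p'.2
          * g j (ν j, p') (μ j, σ j)) := fun σ =>
      (Fintype.prod_sum fun j (p' : Bits d × Bits d) => proj (c j) (σ j).1 p'.1
        * proj (r j) (σ j).2 p'.2 * g j (ν j, p') (μ j, σ j)).symm
    rw [Finset.sum_congr rfl fun σ _ => hprod σ,
      ← Fintype.prod_sum fun j (p : Bits d × Bits d) => ∑ p' : Bits d × Bits d,
        (proj (c j) p.1 p'.1 * proj (r j) p.2 p'.2 * g j (ν j, p') (μ j, p)),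
      ← Finset.mul_prod_erase _ _ (mem_univ i),
      Finset.prod_congr rfl fun j hj => hout j (Finset.ne_of_mem_erase hj), Finset.sum_mul]
    refine Finset.sum_congr rfl fun p _ => ?_
    rw [Finset.sum_mul]
    refine Finset.sum_congr rfl fun p' _ => ?_
    rw [roundEffect_apply, ← Finset.mul_prod_erase _ _ (mem_univ i), if_pos rfl,
      Finset.prod_congr rfl fun j hj => if_neg (Finset.ne_of_mem_erase hj), kroneckerMap_apply,
      mul_assoc]
    simp only [g, if_true]
  have h4 : (A.roundEffect i b * ((proj (c i) ⊗ₖ proj (r i)) ⊗ₖ A.database U)).trace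
      = ∑ μ, ∑ ν, A.database U μ ν *
        ∑ p, ∑ p', (proj (c i) ⊗ₖ proj (r i)) p p' * A.roundEffect i b (p', ν) (p, μ) := by
    simp only [trace, diag_apply, Matrix.mul_apply]
    rw [Finset.sum_comm, Fintype.sum_prod_type, Finset.sum_comm]
    refine Finset.sum_congr rfl fun μ _ => ?_
    rw [Finset.sum_congr rfl fun p _ => Fintype.sum_prod_type_right _, Finset.sum_comm]
    refine Finset.sum_congr rfl fun ν _ => ?_
    simp only [Finset.mul_sum]
    refine Finset.sum_congr rfl fun p _ => Finset.sum_congr rfl fun p' _ => ?_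
    rw [kroneckerMap_apply _ _ (A.database U)]
    ring
  have h5 : ∑ s, ∑ t, A.roundsInput U c r s t * ∏ j, g j (t j) (s j)
      = ∑ μ, ∑ ν, A.database U μ ν * ∑ σ : Fin N → Bits d × Bits d,
        ∑ σ' : Fin N → Bits d × Bits d, ∏ j,
          (proj (c j) (σ j).1 (σ' j).1 * proj (r j) (σ j).2 (σ' j).2
            * g j (ν j, σ' j) (μ j, σ j)) := by
    let e := Equiv.arrowProdEquivProdArrow (Fin N) (fun j => Fin (A.memDim j))
      (fun _ => Bits d × Bits d)
    have hs : ∀ F : (∀ j, RoundReg d (A.memDim j)) → ℂ, ∑ s, F s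
        = ∑ μ : ∀ j, Fin (A.memDim j), ∑ σ : Fin N → Bits d × Bits d, F (fun j => (μ j, σ j)) :=
      fun F => by
      rw [← e.symm.sum_comp, Fintype.sum_prod_type]
      rfl
    simp only [hs, Finset.mul_sum]
    refine Finset.sum_congr rfl fun μ _ => ?_
    rw [Finset.sum_comm]
    refine Finset.sum_congr rfl fun ν _ => Finset.sum_congr rfl fun σ _ =>
      Finset.sum_congr rfl fun σ' _ => ?_
    rw [roundsInput, of_apply, mul_assoc, ← Finset.prod_mul_distrib]
  rw [outputBitProb]
  simp only [outputProb]
  rw [← Complex.re_sum, h2, h5, h4]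
  simp only [h3]

end Eve

end Output

/-! ### Averaging over the protocol and the final estimate -/

section Protocol

theorem Channel.trace_apply {a b : Type} [Fintype a] [DecidableEq a] [Fintype b]
    (Λ : Channel a b) (ρ : Matrix a a ℂ) : (Λ.apply ρ).trace = ρ.trace := by
  have h : ∀ k, (Λ.kraus k * ρ * (Λ.kraus k)ᴴ).trace = ((Λ.kraus k)ᴴ * Λ.kraus k * ρ).trace :=
    fun k => by rw [trace_mul_comm, Matrix.mul_assoc]
  rw [Channel.apply, trace_sum, Finset.sum_congr rfl fun k _ => h k, ← trace_sum,
    ← Finset.sum_mul, Λ.tracePreserving, one_mul]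

theorem proj_mulVec {n : Type} [Fintype n] (U : Matrix n n ℂ) (v : n → ℂ) :
    proj (U *ᵥ v) = U * proj v * Uᴴ := by
  rw [proj, proj, mul_vecMulVec, vecMulVec_mul, star_mulVec]

theorem proj_ket {d : ℕ} (x : Bits d) : proj (ket x) = single x x 1 := by
  ext i j
  simp only [proj, ket, vecMulVec_apply, single_apply, Pi.single_apply, Pi.star_apply]
  by_cases hi : i = x <;> by_cases hj : j = x <;> simp [hi, hj, eq_comm (a := x)]

theorem dotProduct_unitary {n : Type} [Fintype n] [DecidableEq n] (U : UGroup n) (v : n → ℂ) :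
    star ((U : Matrix n n ℂ) *ᵥ v) ⬝ᵥ ((U : Matrix n n ℂ) *ᵥ v) = star v ⬝ᵥ v := by
  have h : (U : Matrix n n ℂ)ᴴ * (U : Matrix n n ℂ) = 1 := Unitary.star_mul_self_of_mem U.2
  rw [star_mulVec, dotProduct_mulVec, vecMul_vecMul, h, vecMul_one]

theorem dotProduct_ket {d : ℕ} (x : Bits d) : star (ket x) ⬝ᵥ ket x = 1 := by
  simp [ket]

/-- Complementation permutes the subsets of size `N / 2` and exchanges those that contain `i` with
those that do not. -/
theorem expect_mem_powersetCard_half {N : ℕ} (hN : Even N) (i : Fin N) (a c : ℝ) :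
    𝔼 P ∈ powersetCard (N / 2) (univ : Finset (Fin N)), (if i ∈ P then a else c) = (a + c) / 2 := by
  obtain ⟨m, rfl⟩ := hN
  have hm : (m + m) / 2 = m := by omega
  rw [hm]
  set s := powersetCard m (univ : Finset (Fin (m + m)))
  have hcompl : ∀ P ∈ s, Pᶜ ∈ s := fun P hP => by
    rw [mem_powersetCard_univ] at hP ⊢
    rw [card_compl, hP, Fintype.card_fin]
    omega
  have h1 : ∑ P ∈ s, (if i ∈ P then a else c) = ∑ P ∈ s, (if i ∈ P then c else a) :=
    Finset.sum_bij' (fun P _ => Pᶜ) (fun P _ => Pᶜ) hcompl hcompl (fun P _ => compl_compl P)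
      (fun P _ => compl_compl P) fun P _ => by by_cases h : i ∈ P <;> simp [h]
  have h2 : ∑ P ∈ s, (if i ∈ P then a else c) + ∑ P ∈ s, (if i ∈ P then c else a)
      = #s * (a + c) := by
    rw [← Finset.sum_add_distrib, Finset.sum_congr rfl (g := fun _ => a + c), Finset.sum_const,
      nsmul_eq_mul]
    intro P _
    split_ifs <;> ring
  have hs : (0 : ℝ) < #s := by
    rw [Nat.cast_pos, Finset.card_pos]
    exact powersetCard_nonempty.mpr (by simp)
  rw [Finset.expect_eq_sum_div_card, div_eq_div_iff hs.ne' two_ne_zero]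
  linarith

theorem continuous_expect {n : Type} [Fintype n] [DecidableEq n] {ι : Type*} (s : Finset ι)
    {f : ι → UGroup n → ℝ} (hf : ∀ i ∈ s, Continuous (f i)) :
    Continuous fun E => 𝔼 i ∈ s, f i E := by
  simp only [Finset.expect_eq_sum_div_card]
  exact (continuous_finsetSum _ hf).div_const _

theorem integral_expect {n : Type} [Fintype n] [DecidableEq n] {ι : Type*} (s : Finset ι)
    {f : ι → UGroup n → ℝ} (hf : ∀ i ∈ s, Continuous (f i)) :
    ∫ E, 𝔼 i ∈ s, f i E ∂haarU n = 𝔼 i ∈ s, ∫ E, f i E ∂haarU n := by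
  simp only [Finset.expect_eq_sum_div_card]
  rw [integral_div, integral_finsetSum _ fun i hi => integrable_of_continuous (hf i hi)]

namespace Eve

variable {d N : ℕ} (A : Eve d N)

theorem trace_stateAfter (U : UGroup (Bits d)) (t : ℕ) : (A.stateAfter U t).trace = 1 := by
  induction t with
  | zero => exact A.init_trace
  | succ t ih =>
    have h : (U : Matrix (Bits d) (Bits d) ℂ)ᴴ * (U : Matrix (Bits d) (Bits d) ℂ) = 1 :=
      Unitary.star_mul_self_of_mem U.2
    rw [stateAfter, Channel.trace_apply, trace_mul_comm, ← mul_assoc, conjTranspose_kronecker,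
      ← mul_kronecker_mul, h]
    simpa using ih

theorem trace_database (U : UGroup (Bits d)) : (A.database U).trace = 1 := by
  rw [database, Channel.trace_apply, trace_stateAfter]

theorem continuous_trace_mul_database
    (M : Matrix ((Bits d × Bits d) × (∀ i, Fin (A.memDim i))) _ ℂ)
    {X : UGroup (Bits d) → Matrix (Bits d × Bits d) (Bits d × Bits d) ℂ} (hX : Continuous X) :
    Continuous fun U => (M * (X U ⊗ₖ A.database U)).trace := by
  simp only [trace_mul_database]
  have h := (hasTwist_heis (ι := A.regC) (κ := A.regQ)
    (fun X Y => commute_leftReg_rightReg _ _) A.isStep_regC (A.store.adj _ M) A.queries).1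
  refine Continuous.matrix_trace (h.matrix_mul (continuous_matrix fun i j => ?_))
  simp only [kroneckerMap_apply]
  exact (hX.matrix_elem _ _).mul continuous_const

theorem norm_trace_database_le (U : UGroup (Bits d))
    (M : Matrix ((Bits d × Bits d) × (∀ i, Fin (A.memDim i))) _ ℂ) (hM : ‖M‖ ≤ 1) :
    ‖(M * ((1 : Matrix (Bits d × Bits d) (Bits d × Bits d) ℂ) ⊗ₖ A.database U)).trace‖
      ≤ (2 ^ d) ^ 2 := by
  rw [trace_mul_database]
  have hR : ((1 : Matrix (Bits d × Bits d) (Bits d × Bits d) ℂ) ⊗ₖ A.init).PosSemidef :=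
    PosSemidef.one.kronecker A.init_posSemidef
  refine (norm_trace_mul_posSemidef_le _ hR).trans ?_
  rw [show ((1 : Matrix (Bits d × Bits d) (Bits d × Bits d) ℂ) ⊗ₖ A.init).trace
    = ((Fintype.card (Bits d) ^ 2 : ℕ) : ℂ) by simp [trace_kronecker, A.init_trace, sq],
    Complex.natCast_re]
  refine (mul_le_of_le_one_right (by positivity) (norm_heis_le A.isStep_regC
    ((Channel.norm_adj_le _ _).trans hM) _ _)).trans (by simp)

/-- The statistics of the output bit `b` of round `i`, as a functional of the joint state of the
challenge and of the other state before the qPUF is applied to it. -/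
noncomputable def roundFunctional (U : UGroup (Bits d)) (i : Fin N) (b : Bool) :
    Matrix (Bits d × Bits d) (Bits d × Bits d) ℂ →ₗ[ℂ] ℂ where
  toFun P := (A.roundEffect i b * ((((1 : Matrix (Bits d) (Bits d) ℂ) ⊗ₖ U.1) * P *
    ((1 : Matrix (Bits d) (Bits d) ℂ) ⊗ₖ U.1)ᴴ) ⊗ₖ A.database U)).trace
  map_add' P Q := by simp only [mul_add, add_mul, add_kronecker, trace_add]
  map_smul' c P := by
    simp only [mul_smul_comm, smul_mul_assoc, smul_kronecker, trace_smul, RingHom.id_apply]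

theorem roundFunctional_apply (U : UGroup (Bits d)) (i : Fin N) (b : Bool) (P) :
    A.roundFunctional U i b P = (A.roundEffect i b *
      ((((1 : Matrix (Bits d) (Bits d) ℂ) ⊗ₖ U.1) * P *
        ((1 : Matrix (Bits d) (Bits d) ℂ) ⊗ₖ U.1)ᴴ) ⊗ₖ A.database U)).trace := rfl

theorem roundFunctional_one (U : UGroup (Bits d)) (i : Fin N) (b : Bool) :
    A.roundFunctional U i b 1 = (A.roundEffect i b *
      ((1 : Matrix (Bits d × Bits d) (Bits d × Bits d) ℂ) ⊗ₖ A.database U)).trace := by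
  have h : U.1 * U.1ᴴ = 1 := Unitary.mul_star_self_of_mem U.2
  rw [roundFunctional_apply, mul_one, conjTranspose_kronecker, ← mul_kronecker_mul, h]
  simp

/-- The identity behind it is `(1 ⊗ U) F (1 ⊗ U†) = F (U ⊗ U†)`: the correlation of challenge and
response becomes an extra use of `U` and of `U†`. -/
theorem roundFunctional_swapMat (U : UGroup (Bits d)) (i : Fin N) (b : Bool) :
    A.roundFunctional U i b (swapMat (Bits d)) = (A.roundEffect i b *
      ((swapMat (Bits d) * ((U : Matrix (Bits d) (Bits d) ℂ) ⊗ₖ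
        star (U : Matrix (Bits d) (Bits d) ℂ))) ⊗ₖ A.database U)).trace := by
  rw [roundFunctional_apply, kronecker_mul_swapMat, mul_assoc, conjTranspose_kronecker,
    ← mul_kronecker_mul]
  simp [star_eq_conjTranspose]

theorem outputBitProb_eq_roundFunctional (U E : UGroup (Bits d)) (c r : Fin N → Bits d → ℂ)
    (hc : ∀ j, star (c j) ⬝ᵥ c j = 1) (hr : ∀ j, star (r j) ⬝ᵥ r j = 1) (i : Fin N) (b : Bool)
    (x y : Bits d) (hci : c i = E.1 *ᵥ ket x) (hri : r i = U.1 *ᵥ (E.1 *ᵥ ket y)) :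
    A.outputBitProb U c r i b = (A.roundFunctional U i b ((E.1 ⊗ₖ E.1) *
      (single x x 1 ⊗ₖ single y y 1) * (E.1 ⊗ₖ E.1)ᴴ)).re := by
  rw [outputBitProb_eq A U c r hc hr, roundFunctional_apply, hci, hri, proj_mulVec, proj_mulVec,
    proj_mulVec, proj_ket, proj_ket]
  simp only [conjTranspose_kronecker, ← mul_kronecker_mul, conjTranspose_one, one_mul, mul_one]

theorem outputBitProb_false (U : UGroup (Bits d)) (c r : Fin N → Bits d → ℂ)
    (hc : ∀ j, star (c j) ⬝ᵥ c j = 1) (hr : ∀ j, star (r j) ⬝ᵥ r j = 1) (i : Fin N) :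
    A.outputBitProb U c r i false = 1 - A.outputBitProb U c r i true := by
  have h := congrArg (fun M => (M * ((proj (c i) ⊗ₖ proj (r i)) ⊗ₖ A.database U)).trace.re)
    (A.sum_roundEffect i)
  have hp : ∀ v : Bits d → ℂ, (proj v).trace = star v ⬝ᵥ v := fun v => sum_diag_proj v
  simp only [Fintype.sum_bool, add_mul, trace_add, Complex.add_re, one_mul, trace_kronecker, hp,
    hc, hr, trace_database, Complex.one_re, mul_one] at h
  rw [outputBitProb_eq A U c r hc hr, outputBitProb_eq A U c r hc hr]
  linarith

theorem integral_roundFunctional (U : UGroup (Bits d)) (i : Fin N) (b : Bool)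
    (P : Matrix (Bits d × Bits d) (Bits d × Bits d) ℂ) :
    ∫ E : UGroup (Bits d), (A.roundFunctional U i b ((E.1 ⊗ₖ E.1) * P * (E.1 ⊗ₖ E.1)ᴴ)).re
      ∂haarU (Bits d) = (twirl (A.roundFunctional U i b) P).re :=
  Complex.reCLM.integral_comp_comm
    (integrable_of_continuous (continuous_twirl (A.roundFunctional U i b) P))

end Eve

/-- The average over everything except the qPUF. -/
theorem integral_round {d N K : ℕ} (hd : 1 ≤ d) (hN : Even N) (hNK : N ≤ K) (A : Eve d N)
    (i : Fin N) (U : UGroup (Bits d)) :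
    ∫ E : UGroup (Bits d),
      (𝔼 x : Fin K → Bits d, 𝔼 y : (∀ k, {z : Bits d // z ≠ x k}),
        𝔼 sel : Fin N ↪ Fin K, 𝔼 P ∈ powersetCard (N / 2) (univ : Finset (Fin N)),
          A.outputBitProb U
            (fun j => E.1 *ᵥ ket (x (sel j)))
            (fun j => if j ∈ P then U.1 *ᵥ (E.1 *ᵥ ket (x (sel j)))
              else U.1 *ᵥ (E.1 *ᵥ ket (y (sel j)).1))
            i (decide (i ∈ P))) ∂haarU (Bits d)
      = 1 / 2 + ((2 ^ d * A.roundFunctional U i true (swapMat (Bits d))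
          - A.roundFunctional U i true 1) / (2 ^ d * ((2 ^ d) ^ 2 - 1))).re / 2 := by
  set L := A.roundFunctional U i true
  -- `α` and `β` are the averaged probabilities of the output `1` on a valid response and on a trap.
  -- The guess is right with probability `(α + 1 - β) / 2`.
  set α : ℝ := ((L 1 + L (swapMat (Bits d))) / (2 ^ d * (2 ^ d + 1))).re with hα
  set β : ℝ := ((2 ^ d * L 1 - L (swapMat (Bits d))) / (2 ^ d * ((2 ^ d) ^ 2 - 1))).re with hβ
  have hcard : (Fintype.card (Bits d) : ℂ) = 2 ^ d := by simp
  have h0 : (2 : ℂ) ^ d ≠ 0 := by positivity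
  have h1 : (2 : ℂ) ^ d + 1 ≠ 0 := by exact_mod_cast (by positivity : 2 ^ d + 1 ≠ 0)
  have h2 : (2 : ℂ) ^ d - 1 ≠ 0 := by
    rw [sub_ne_zero]
    exact_mod_cast (Nat.one_lt_two_pow (by omega)).ne'
  have h3 : ((2 : ℂ) ^ d) ^ 2 - 1 ≠ 0 := by
    rw [show ((2 : ℂ) ^ d) ^ 2 - 1 = (2 ^ d + 1) * (2 ^ d - 1) by ring]
    exact mul_ne_zero h1 h2
  have hxx : ∀ x y : Bits d, x ≠ y → (twirl L (single x x 1 ⊗ₖ single x x 1)).re = α := by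
    intro x y hxy
    have h := (second_moment L hxy).1
    rw [hcard] at h
    rw [hα, ← h, mul_div_cancel_left₀ _ (mul_ne_zero h0 h1)]
  have hxy : ∀ x y : Bits d, x ≠ y → (twirl L (single x x 1 ⊗ₖ single y y 1)).re = β := by
    intro x y hxy
    obtain ⟨h, h'⟩ := second_moment L hxy
    rw [hcard] at h h'
    rw [hβ]
    congr 1
    rw [eq_div_iff (mul_ne_zero h0 h3)]
    linear_combination (2 ^ d + 1) * h' - h
  have hval : α - β = ((2 ^ d * L (swapMat (Bits d)) - L 1) / (2 ^ d * ((2 ^ d) ^ 2 - 1))).re := by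
    rw [hα, hβ, ← Complex.sub_re]
    congr 1
    field_simp
    ring
  have hunit : ∀ (E : UGroup (Bits d)) (x : Bits d), star (E.1 *ᵥ ket x) ⬝ᵥ (E.1 *ᵥ ket x) = 1 :=
    fun E x => by rw [dotProduct_unitary, dotProduct_ket]
  have hterm : ∀ (x : Fin K → Bits d) (y : ∀ k, {z : Bits d // z ≠ x k}) (sel : Fin N ↪ Fin K)
      (P : Finset (Fin N)) (E : UGroup (Bits d)),
      A.outputBitProb U (fun j => E.1 *ᵥ ket (x (sel j)))
        (fun j => if j ∈ P then U.1 *ᵥ (E.1 *ᵥ ket (x (sel j)))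
          else U.1 *ᵥ (E.1 *ᵥ ket (y (sel j)).1)) i (decide (i ∈ P))
      = if i ∈ P then (L ((E.1 ⊗ₖ E.1) * (single (x (sel i)) (x (sel i)) 1 ⊗ₖ
            single (x (sel i)) (x (sel i)) 1) * (E.1 ⊗ₖ E.1)ᴴ)).re
        else 1 - (L ((E.1 ⊗ₖ E.1) * (single (x (sel i)) (x (sel i)) 1 ⊗ₖ
            single (y (sel i)).1 (y (sel i)).1 1) * (E.1 ⊗ₖ E.1)ᴴ)).re := by
    intro x y sel P E
    have hr : ∀ j, star (if j ∈ P then U.1 *ᵥ (E.1 *ᵥ ket (x (sel j)))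
        else U.1 *ᵥ (E.1 *ᵥ ket (y (sel j)).1)) ⬝ᵥ (if j ∈ P then U.1 *ᵥ (E.1 *ᵥ ket (x (sel j)))
        else U.1 *ᵥ (E.1 *ᵥ ket (y (sel j)).1)) = 1 := by
      intro j
      split_ifs <;> rw [dotProduct_unitary, hunit]
    by_cases hi : i ∈ P
    · rw [if_pos hi, decide_eq_true hi]
      exact A.outputBitProb_eq_roundFunctional U E _ _ (fun j => hunit E _) hr i true _ _ rfl
        (if_pos hi)
    · rw [if_neg hi, decide_eq_false hi, A.outputBitProb_false U _ _ (fun j => hunit E _) hr,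
        A.outputBitProb_eq_roundFunctional U E _ _ (fun j => hunit E _) hr i true _ _ rfl
          (if_neg hi)]
  have hcont : ∀ (x : Fin K → Bits d) (y : ∀ k, {z : Bits d // z ≠ x k}) (sel : Fin N ↪ Fin K)
      (P : Finset (Fin N)), Continuous fun E : UGroup (Bits d) =>
      A.outputBitProb U (fun j => E.1 *ᵥ ket (x (sel j)))
        (fun j => if j ∈ P then U.1 *ᵥ (E.1 *ᵥ ket (x (sel j)))
          else U.1 *ᵥ (E.1 *ᵥ ket (y (sel j)).1)) i (decide (i ∈ P)) := by
    intro x y sel P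
    simp only [hterm]
    split_ifs
    · exact Complex.continuous_re.comp (continuous_twirl L _)
    · exact continuous_const.sub (Complex.continuous_re.comp (continuous_twirl L _))
  have hint : ∀ (x : Fin K → Bits d) (y : ∀ k, {z : Bits d // z ≠ x k}) (sel : Fin N ↪ Fin K)
      (P : Finset (Fin N)), ∫ E : UGroup (Bits d),
      A.outputBitProb U (fun j => E.1 *ᵥ ket (x (sel j)))
        (fun j => if j ∈ P then U.1 *ᵥ (E.1 *ᵥ ket (x (sel j)))
          else U.1 *ᵥ (E.1 *ᵥ ket (y (sel j)).1)) i (decide (i ∈ P)) ∂haarU (Bits d)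
      = if i ∈ P then α else 1 - β := by
    intro x y sel P
    simp only [hterm]
    -- The trap string also serves in the valid case, where `hxx` only needs some second basis
    -- label.
    have hne := (y (sel i)).2.symm
    split_ifs
    · rw [A.integral_roundFunctional, hxx _ _ hne]
    · have hI := integrable_of_continuous (Complex.continuous_re.comp (continuous_twirl L
        (single (x (sel i)) (x (sel i)) 1 ⊗ₖ single (y (sel i)).1 (y (sel i)).1 1)))
      simp only [Function.comp_def] at hI
      rw [integral_sub (integrable_const _) hI, A.integral_roundFunctional, hxy _ _ hne]
      simp
  have c3 := fun x y sel => continuous_expect (powersetCard (N / 2) (univ : Finset (Fin N)))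
    fun P _ => hcont x y sel P
  have c2 := fun x y => continuous_expect (univ : Finset (Fin N ↪ Fin K)) fun sel _ => c3 x y sel
  have c1 := fun x => continuous_expect (univ : Finset (∀ k, {z : Bits d // z ≠ x k}))
    fun y _ => c2 x y
  rw [integral_expect _ fun x _ => c1 x]
  simp only [integral_expect _ fun y _ => c2 _ y, integral_expect _ fun sel _ => c3 _ _ sel,
    integral_expect _ fun P _ => hcont _ _ _ P, hint, expect_mem_powersetCard_half hN]
  -- An average over an empty type would be `0`, so nonemptiness is needed: selections exist as `N ≤
  -- K`, and flipping all bits gives a different string as `1 ≤ d`.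
  have hsel : Nonempty (Fin N ↪ Fin K) := ⟨Fin.castLEEmb hNK⟩
  have hy : ∀ x : Fin K → Bits d, Nonempty (∀ k, {z : Bits d // z ≠ x k}) := fun x =>
    ⟨fun k => ⟨fun j => !(x k j), fun h => by simpa using congrFun h ⟨0, hd⟩⟩⟩
  simp only [Finset.expect_const univ_nonempty]
  rw [← hval]
  ring

/-- In `(D F - 1) / (D (D² - 1))` the swap is bounded by integration by parts; for the identity the
trivial bound `D²` is enough. -/
theorem abs_guessProb_sub_half_le {d N K : ℕ} (hd : 1 ≤ d) (hN : Even N) (hNK : N ≤ K)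
    (A : Eve d N) (i : Fin N) : |guessProb d N K A i - 1 / 2|
      ≤ (2 ^ d * (2 ^ d + 8 * A.queries ^ 2 + 2 * A.queries) + (2 ^ d) ^ 2)
        / (2 ^ d * ((2 ^ d) ^ 2 - 1)) / 2 := by
  have cF : Continuous fun U => A.roundFunctional U i true (swapMat (Bits d)) := by
    simp only [Eve.roundFunctional_swapMat]
    refine A.continuous_trace_mul_database _ (continuous_const.matrix_mul
      (continuous_matrix fun j k => ?_))
    simp only [kroneckerMap_apply]
    exact (continuous_subtype_val.matrix_elem _ _).mul
      (continuous_subtype_val.star.matrix_elem _ _)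
  have c1 : Continuous fun U => A.roundFunctional U i true 1 := by
    simp only [Eve.roundFunctional_one]
    exact A.continuous_trace_mul_database _ continuous_const
  have bF : ‖∫ U, A.roundFunctional U i true (swapMat (Bits d)) ∂haarU (Bits d)‖
      ≤ 2 ^ d + 8 * A.queries ^ 2 + 2 * A.queries := by
    simp only [Eve.roundFunctional_swapMat]
    exact A.norm_integral_trace_swap_le _ (A.norm_roundEffect_le i true)
  have b1 : ‖∫ U, A.roundFunctional U i true 1 ∂haarU (Bits d)‖ ≤ (2 ^ d) ^ 2 :=
    norm_integral_haarU_le fun U => by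
      rw [Eve.roundFunctional_one]
      exact A.norm_trace_database_le U _ (A.norm_roundEffect_le i true)
  set G : UGroup (Bits d) → ℂ := fun U => (2 ^ d * A.roundFunctional U i true (swapMat (Bits d))
    - A.roundFunctional U i true 1) / (2 ^ d * ((2 ^ d) ^ 2 - 1)) with hG
  have iG : Integrable G (haarU (Bits d)) :=
    integrable_of_continuous (((continuous_const.mul cF).sub c1).div_const _)
  have hG' : ∫ U, G U ∂haarU (Bits d)
      = (2 ^ d * (∫ U, A.roundFunctional U i true (swapMat (Bits d)) ∂haarU (Bits d))
        - ∫ U, A.roundFunctional U i true 1 ∂haarU (Bits d)) / (2 ^ d * ((2 ^ d) ^ 2 - 1)) := by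
    rw [hG, integral_div, integral_sub ((integrable_of_continuous cF).const_mul _)
      (integrable_of_continuous c1), integral_const_mul]
  have hre : ∫ U, (G U).re ∂haarU (Bits d) = (∫ U, G U ∂haarU (Bits d)).re :=
    Complex.reCLM.integral_comp_comm iG
  have hguess : guessProb d N K A i = 1 / 2 + (∫ U, G U ∂haarU (Bits d)).re / 2 := by
    rw [guessProb, integral_congr_ae (Filter.Eventually.of_forall fun U =>
      integral_round hd hN hNK A i U)]
    have hI : Integrable (fun U => (G U).re / 2) (haarU (Bits d)) := iG.re.div_const 2
    change ∫ U, (1 / 2 + (G U).re / 2) ∂haarU (Bits d) = _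
    rw [integral_add (integrable_const _) hI,
      integral_div (μ := haarU (Bits d)) 2 (fun U => (G U).re), hre]
    simp
  rw [hguess, add_sub_cancel_left, abs_div, abs_two]
  refine div_le_div_of_nonneg_right ((Complex.abs_re_le_norm _).trans ?_) zero_le_two
  have hD : (1 : ℝ) ≤ (2 ^ d) ^ 2 := one_le_pow₀ (one_le_pow₀ one_le_two)
  have hden : ‖(2 ^ d * ((2 ^ d) ^ 2 - 1) : ℂ)‖ = 2 ^ d * ((2 ^ d) ^ 2 - 1) := by
    have : (2 ^ d * ((2 ^ d) ^ 2 - 1) : ℂ) = ((2 ^ d * ((2 ^ d) ^ 2 - 1) : ℝ) : ℂ) := by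
      push_cast
      rfl
    rw [this, Complex.norm_real, Real.norm_of_nonneg]
    exact mul_nonneg (by positivity) (by linarith)
  rw [hG', norm_div, hden]
  refine div_le_div_of_nonneg_right ?_ (mul_nonneg (by positivity) (by linarith))
  refine norm_sub_le_of_le ?_ b1
  rw [norm_mul, norm_pow, Complex.norm_ofNat]
  gcongr

theorem exists_sq_eval_le (p : Polynomial ℕ) :
    ∃ C : ℝ, ∀ d : ℕ, ((p.eval d : ℕ) : ℝ) ^ 2 ≤ C * 2 ^ d := by
  have h : ∃ C : ℝ, ∀ d : ℕ, (((p ^ 2).eval d : ℕ) : ℝ) ≤ C * 2 ^ d := by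
    induction p ^ 2 using Polynomial.induction_on' with
    | add p q hp hq =>
      obtain ⟨C, hC⟩ := hp
      obtain ⟨C', hC'⟩ := hq
      refine ⟨C + C', fun d => ?_⟩
      rw [Polynomial.eval_add, Nat.cast_add, add_mul]
      exact add_le_add (hC d) (hC' d)
    | monomial k a =>
      obtain ⟨C, hC⟩ := (tendsto_pow_const_div_const_pow_of_one_lt k
        (one_lt_two (α := ℝ))).bddAbove_range
      refine ⟨a * C, fun d => ?_⟩
      have h1 := hC ⟨d, rfl⟩
      rw [div_le_iff₀ (by positivity)] at h1
      rw [Polynomial.eval_monomial]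
      push_cast
      rw [mul_assoc]
      gcongr
  simpa using h

end Protocol

end QPUF

theorem mainTheorem4 (p : Polynomial ℕ) :
    ∃ C : ℝ, ∀ (d N K : ℕ), 1 ≤ d → Even N → N ≤ K →
      ∀ A : QPUF.Eve d N, A.queries ≤ p.eval d →
        ∀ i : Fin N, |QPUF.guessProb d N K A i - 1 / 2| ≤ C * ((2 : ℝ) ^ d)⁻¹ := by
  obtain ⟨C, hC⟩ := QPUF.exists_sq_eval_le p
  -- From `q ≤ q² ≤ C D` the numerator is at most `(2 + 10 C) D²`, and `D² ≤ 2 (D² - 1)` because `D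
  -- ≥ 2`.
  refine ⟨2 + 10 * C, fun d N K hd hN hNK A hA i => ?_⟩
  refine (QPUF.abs_guessProb_sub_half_le hd hN hNK A i).trans ?_
  have hq : (A.queries : ℝ) ^ 2 ≤ C * 2 ^ d := le_trans (by gcongr) (hC d)
  have hq1 : (A.queries : ℝ) ≤ (A.queries : ℝ) ^ 2 := by
    exact_mod_cast Nat.le_self_pow two_ne_zero _
  have hD : (2 : ℝ) ≤ 2 ^ d := le_self_pow₀ one_le_two (by omega)
  set D : ℝ := 2 ^ d
  set q : ℝ := (A.queries : ℝ)
  have hC0 : 0 ≤ C := nonneg_of_mul_nonneg_left ((sq_nonneg q).trans hq) (by linarith)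
  have hD2 : 0 < D ^ 2 - 1 := by nlinarith
  rw [div_div, div_le_iff₀ (by positivity)]
  have h1 : (2 + 10 * C) * D⁻¹ * (D * (D ^ 2 - 1) * 2) = (2 + 10 * C) * (D ^ 2 - 1) * 2 := by
    field_simp
  rw [h1]
  nlinarith [mul_le_mul_of_nonneg_left hq (by linarith : 0 ≤ D)]
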